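/- Let $m \ge 1$, let $J:\mathbb R\to[0,\infty)$ be convex with $J(0)=0$, and let $k\in L^1(\mathbb R^m)$ be symmetric decreasing, i.e. $k(x)\ge k(y)$ whenever $0<|x|\le |y|$ (the value at the origin is immaterial). Let $f,g:\mathbb R^m\to[0,\infty)$ be measurable functions such that $|\{f>\tau\}|$ and $|\{g>\tau\}|$ are finite for all $\tau>0$, and put $$\mathcal E[f,g]:=\int_{\mathbb R^m}\int_{\mathbb R^m}J(f(x)-g(y))\,k(x-y)\,dy\,dx\in[0,\infty].$$ For $E\subseteq\mathbb R^m$ let $E^*$ be the open ball around the origin with $|E^*|=|E|$ (and $E^*=\mathbb R^m$ if $|E|=\infty$), and let $f^*(x):=\sup\{\tau>0: x\in\{|f|>\tau\}^*\}$ (with $\sup\emptyset=0$) be the symmetric decreasing rearrangement of $f$. 1. One has $\mathcal E[f,g]\ge\mathcal E[f^*,g^*]$. 2. Suppose moreover that $\mathcal E[f,g]<\infty$ and that $k$ is strictly symmetric decreasing, i.e. also $k(x)>k(y)$ whenever $0<|x|<|y|$. (a) If $J$ is strictly convex, then $\mathcal E[f,g]=\mathcal E[f^*,g^*]$ if and only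 if $f=0$ a.e., or $g=0$ a.e., or there exists $c\in\mathbb R^m$ such that $f(x)=f^*(x-c)$ and $g(x)=g^*(x-c)$ for a.e. $x\in\mathbb R^m$. (b) If $J(t)=|t|$, then $\mathcal E[f,g]=\mathcal E[f^*,g^*]$ if and only if for a.e. $\tau>0$ at which both level sets $\{f>\tau\}$ and $\{g>\tau\}$ have positive measure there exists $c_\tau\in\mathbb R^m$ such that these two level sets agree, up to sets of measure zero, with balls centered at $c_\tau$. -/

import Mathlib

open MeasureTheory Set

noncomputable section

/-- Schwarz symmetrization of a set: the whole space if `E` has infinite measure, and otherwise the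
open ball around the origin, with radius `(|E| / |B|) ^ (1 / m)`, that has the measure of `E`. -/
def schwarzSymm {m : ℕ} (E : Set (EuclideanSpace ℝ (Fin m))) : Set (EuclideanSpace ℝ (Fin m)) :=
  open Classical in
  if volume E = ⊤ then univ
  else Metric.ball 0
    ((volume E / volume (Metric.ball (0 : EuclideanSpace ℝ (Fin m)) 1)).toReal ^ (m : ℝ)⁻¹)

/-- Schwarz symmetrization preserves the measure. -/
theorem volume_schwarzSymm {m : ℕ} (hm : 1 ≤ m) (E : Set (EuclideanSpace ℝ (Fin m))) :
    volume (schwarzSymm E) = volume E := by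
  have : Nonempty (Fin m) := ⟨⟨0, hm⟩⟩
  unfold schwarzSymm
  split_ifs with h
  · rw [h]
    exact measure_univ_of_isAddLeftInvariant volume
  · have hB0 : volume (Metric.ball (0 : EuclideanSpace ℝ (Fin m)) 1) ≠ 0 :=
      (Metric.measure_ball_pos volume _ one_pos).ne'
    have hBt : volume (Metric.ball (0 : EuclideanSpace ℝ (Fin m)) 1) ≠ ⊤ :=
      measure_ball_lt_top.ne
    have hm0 : m ≠ 0 := by omega
    rw [Measure.addHaar_ball volume _ (by positivity), finrank_euclideanSpace_fin,
      Real.rpow_inv_natCast_pow ENNReal.toReal_nonneg hm0,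
      ENNReal.ofReal_toReal (ENNReal.div_ne_top h hB0), ENNReal.div_mul_cancel hB0 hBt]

/-- The symmetric decreasing rearrangement `f^*(x) = sup {τ > 0 | x ∈ {|f| > τ}^*}`, for `f` all of
whose level sets `{|f| > τ}`, `τ > 0`, have finite measure. The supremum is finite for `x ≠ 0`; at
the single point `x = 0` it is infinite if `f` is essentially unbounded, and then the real-valued
`sSup` is `0` there. -/
def symmDecrRearr {m : ℕ} (f : EuclideanSpace ℝ (Fin m) → ℝ) (x : EuclideanSpace ℝ (Fin m)) : ℝ :=
  sSup {τ : ℝ | 0 < τ ∧ x ∈ schwarzSymm {y | τ < |f y|}}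

/-- `k` is symmetric decreasing (hence radial). The value at the origin is left free, so that
kernels with a singularity there are included. -/
def IsSymmDecr {m : ℕ} (k : EuclideanSpace ℝ (Fin m) → ℝ) : Prop :=
  ∀ x y, x ≠ 0 → ‖x‖ ≤ ‖y‖ → k y ≤ k x

/-- `k(x) > k(y)` whenever `0 < |x| < |y|`. -/
def IsStrictSymmDecr {m : ℕ} (k : EuclideanSpace ℝ (Fin m) → ℝ) : Prop :=
  ∀ x y, x ≠ 0 → ‖x‖ < ‖y‖ → k y < k x

/-- The functional `∬ J(f(x) - g(y)) k(x - y) dy dx`, with values in `[0, ∞]`. -/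
def nonlocalEnergy {m : ℕ} (J : ℝ → ℝ) (k f g : EuclideanSpace ℝ (Fin m) → ℝ) : ENNReal :=
  ∫⁻ x, ∫⁻ y, ENNReal.ofReal (J (f x - g y) * k (x - y))

end

/-! The layer cake formula reduces functions to sets. On each half-line `J` is the double integral
of a positive measure `ν`, its second derivative together with the mass of the one-sided slope at
the origin. For `a ≥ b ≥ 0` this makes `J (a - b)` the mass, under `dτ dν(s)`, of the levels with `τ
> 0` and `b ≤ τ`, `τ + s < a`. The energy is therefore a superposition of interactions of `{f > τ +
s}` with the complement of `{g > τ}`, plus the same with `f` and `g` exchanged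
(`nonlocalEnergy_eq_layerEnergy_add`). Since the kernel is integrable, the interaction of `A` with
`Bᶜ` is `|A| ∫ K` minus that of `A` with `B`, so part 1 follows from Riesz's inequality `I(A, B) ≤
I(A*, B*)`.

Riesz's inequality is proved by polarization. Grouping points with their mirror images shows that
polarizing both sets never lowers `I`. If the origin is on the favoured side, polarization does not
increase `|A \ A*|`, and averaging over all hyperplanes produces one that decreases it by a fixed
multiple of its square. Hence the total distance to the balls has infimum zero over the competitors,
and `I` is continuous in the sets (`interaction_le_interaction_ball_of_bounded`).

If equality holds for a strictly decreasing kernel, every polarization is neutral, so no hyperplane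
orders `A` and `B` in opposite ways. It follows that every hyperplane orders each set in one
direction. Moving the hyperplane parallel to itself, connectedness of the line gives a symmetry
hyperplane in every direction. Orthogonal symmetries compose to a point reflection, whose center
decides which way each hyperplane orders the set. This forces a ball, and the hyperplane bisecting
two distinct centers gives a contradiction (`exists_ae_eq_ball_of_interaction_eq`).

For functions, equality thus means concentric level sets for almost all `(τ, s)`. If `J` is strictly
convex, `ν` charges every interval of positive numbers, which ties all levels to one center. For `J
= |·|` the measure is a Dirac mass at the origin and couples only equal levels. -/

open scoped ENNReal Topology Pointwise

set_option linter.unusedSectionVars false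

/-! ### Reflections in hyperplanes -/

section Reflection

variable {E : Type*} [NormedAddCommGroup E] [InnerProductSpace ℝ E]

/-- Twice the signed distance of `x` to the hyperplane `⟪n, x⟫ = t / 2`, for a unit vector `n`. -/
def height (n : E) (t : ℝ) (x : E) : ℝ := 2 * inner ℝ n x - t

/-- The reflection in the hyperplane `⟪n, x⟫ = t / 2`, for a unit vector `n`. -/
def hyperRefl (n : E) (t : ℝ) (x : E) : E := x - height n t x • n

theorem height_neg (n : E) (t : ℝ) (x : E) : height (-n) (-t) x = -height n t x := by
  simp only [height, inner_neg_left]; ring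

/-- `(n, t)` and `(-n, -t)` are the two orientations of one hyperplane. Reversing the orientation
exchanges gains and losses and can put a given point on the positive side. -/
theorem hyperRefl_neg (n : E) (t : ℝ) (x : E) : hyperRefl (-n) (-t) x = hyperRefl n t x := by
  simp [hyperRefl, height_neg]

theorem continuous_height (n : E) (t : ℝ) : Continuous (height n t) := by
  unfold height; fun_prop

theorem continuous_hyperRefl (n : E) (t : ℝ) : Continuous (hyperRefl n t) := by
  unfold hyperRefl height; fun_prop

variable {n : E} (hn : ‖n‖ = 1) (t : ℝ)
include hn

theorem height_hyperRefl (x : E) : height n t (hyperRefl n t x) = -height n t x := by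
  simp only [hyperRefl, height, inner_sub_right, inner_smul_right, real_inner_self_eq_norm_sq, hn]
  ring

theorem hyperRefl_hyperRefl (x : E) : hyperRefl n t (hyperRefl n t x) = x := by
  rw [hyperRefl, height_hyperRefl hn]
  simp [hyperRefl]

/-- All distance comparisons below are read off from the sign of the product of heights in this
identity. -/
theorem norm_sub_hyperRefl_sq (x y : E) :
    ‖x - hyperRefl n t y‖ ^ 2 = ‖x - y‖ ^ 2 + height n t x * height n t y := by
  have : x - hyperRefl n t y = (x - y) + height n t y • n := by unfold hyperRefl; abel
  rw [this, norm_add_sq_real, norm_smul, hn, inner_smul_right, inner_sub_left,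
    real_inner_comm n x, real_inner_comm n y, mul_one, Real.norm_eq_abs, sq_abs]
  simp only [height]
  ring

theorem norm_hyperRefl_sub_hyperRefl (x y : E) :
    ‖hyperRefl n t x - hyperRefl n t y‖ = ‖x - y‖ := by
  have h : ‖hyperRefl n t x - hyperRefl n t y‖ ^ 2 = ‖x - y‖ ^ 2 := by
    rw [norm_sub_hyperRefl_sq hn, height_hyperRefl hn, norm_sub_rev, norm_sub_hyperRefl_sq hn,
      norm_sub_rev]
    ring
  exact (pow_left_inj₀ (norm_nonneg _) (norm_nonneg _) two_ne_zero).1 h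

theorem norm_hyperRefl_sub (x y : E) : ‖hyperRefl n t x - y‖ = ‖x - hyperRefl n t y‖ := by
  rw [← norm_hyperRefl_sub_hyperRefl hn t, hyperRefl_hyperRefl hn]

theorem norm_sub_le_norm_sub_hyperRefl {x y : E} (h : 0 ≤ height n t x * height n t y) :
    ‖x - y‖ ≤ ‖x - hyperRefl n t y‖ := by
  refine (pow_le_pow_iff_left₀ (norm_nonneg _) (norm_nonneg _) two_ne_zero).1 ?_
  rw [norm_sub_hyperRefl_sq hn]; linarith

theorem norm_sub_hyperRefl_le_norm_sub {x y : E} (h : height n t x * height n t y ≤ 0) :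
    ‖x - hyperRefl n t y‖ ≤ ‖x - y‖ := by
  refine (pow_le_pow_iff_left₀ (norm_nonneg _) (norm_nonneg _) two_ne_zero).1 ?_
  rw [norm_sub_hyperRefl_sq hn]; linarith

theorem norm_sub_lt_norm_sub_hyperRefl {x y : E} (h : 0 < height n t x * height n t y) :
    ‖x - y‖ < ‖x - hyperRefl n t y‖ := by
  refine (pow_lt_pow_iff_left₀ (norm_nonneg _) (norm_nonneg _) two_ne_zero).1 ?_
  rw [norm_sub_hyperRefl_sq hn]; linarith

theorem hyperRefl_eq_reflection (x : E) :
    hyperRefl n t x = t • n + (ℝ ∙ n)ᗮ.reflection x := by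
  rw [Submodule.reflection_orthogonal_apply, Submodule.reflection_singleton_apply]
  simp only [hyperRefl, height, hn, two_smul, sub_smul, mul_smul]
  simp
  abel

theorem measurePreserving_hyperRefl [FiniteDimensional ℝ E] [MeasurableSpace E] [BorelSpace E] :
    MeasurePreserving (hyperRefl n t) (volume : Measure E) volume := by
  have : hyperRefl n t = (fun x => t • n + x) ∘ (ℝ ∙ n)ᗮ.reflection :=
    funext (hyperRefl_eq_reflection hn t)
  rw [this]
  exact (measurePreserving_add_left volume (t • n)).comp
    (LinearIsometryEquiv.measurePreserving (ℝ ∙ n)ᗮ.reflection)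

end Reflection

/-! ### Polarization and the two-point inequality -/

section TwoPoint

variable {E : Type*} [NormedAddCommGroup E] [InnerProductSpace ℝ E] [FiniteDimensional ℝ E]
  [MeasurableSpace E] [BorelSpace E]

/-- The reflection is a homeomorphism, hence a measurable embedding, so no measurability of `F` is
needed. -/
theorem lintegral_comp_hyperRefl {n : E} (hn : ‖n‖ = 1) (t : ℝ) (F : E → ℝ≥0∞) :
    ∫⁻ x, F (hyperRefl n t x) = ∫⁻ x, F x := by
  let e : E ≃ₜ E := ⟨⟨hyperRefl n t, hyperRefl n t, hyperRefl_hyperRefl hn t,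
    hyperRefl_hyperRefl hn t⟩, continuous_hyperRefl n t, continuous_hyperRefl n t⟩
  exact (measurePreserving_hyperRefl hn t).lintegral_comp_emb e.measurableEmbedding F

theorem volume_preimage_hyperRefl {n : E} (hn : ‖n‖ = 1) (t : ℝ) (A : Set E) :
    volume (hyperRefl n t ⁻¹' A) = volume A := by
  let e : E ≃ₜ E := ⟨⟨hyperRefl n t, hyperRefl n t, hyperRefl_hyperRefl hn t,
    hyperRefl_hyperRefl hn t⟩, continuous_hyperRefl n t, continuous_hyperRefl n t⟩
  exact (measurePreserving_hyperRefl hn t).measure_preimage_emb e.measurableEmbedding A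

/-- An integrable interaction kernel that is a decreasing function of the norm. -/
structure IsRadialKernel (K : E → ℝ≥0∞) : Prop where
  measurable : Measurable K
  anti : ∀ x y, ‖x‖ ≤ ‖y‖ → K y ≤ K x
  lintegral_ne_top : ∫⁻ x, K x ≠ ∞

theorem IsRadialKernel.congr_norm {K : E → ℝ≥0∞} (hK : IsRadialKernel K) {x y : E}
    (h : ‖x‖ = ‖y‖) : K x = K y :=
  le_antisymm (hK.anti _ _ h.ge) (hK.anti _ _ h.le)

/-- The interaction energy of two sets. -/
noncomputable def interaction (K : E → ℝ≥0∞) (A B : Set E) : ℝ≥0∞ :=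
  ∫⁻ x, ∫⁻ y, A.indicator 1 x * B.indicator 1 y * K (x - y)

/-- The polarization (two-point rearrangement) of a set with respect to a half-space. -/
def polarization (n : E) (t : ℝ) (A : Set E) : Set E :=
  {x | (0 ≤ height n t x ∧ (x ∈ A ∨ hyperRefl n t x ∈ A)) ∨
    (height n t x < 0 ∧ x ∈ A ∧ hyperRefl n t x ∈ A)}

theorem measurableSet_polarization (n : E) (t : ℝ) {A : Set E} (hA : MeasurableSet A) :
    MeasurableSet (polarization n t A) := by
  have h1 : MeasurableSet {x : E | 0 ≤ height n t x} :=
    measurableSet_le measurable_const (continuous_height n t).measurable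
  have h2 : MeasurableSet {x : E | height n t x < 0} :=
    measurableSet_lt (continuous_height n t).measurable measurable_const
  have h3 : MeasurableSet {x : E | hyperRefl n t x ∈ A} :=
    (continuous_hyperRefl n t).measurable hA
  exact (h1.inter (hA.union h3)).union (h2.inter (hA.inter h3))

/-- The energy density of two sets, summed over the four pairs of mirror images. -/
noncomputable def mirrorSum (K : E → ℝ≥0∞) (n : E) (t : ℝ) (A B : Set E) (x y : E) : ℝ≥0∞ :=
  (A.indicator 1 x * B.indicator 1 y +
    A.indicator 1 (hyperRefl n t x) * B.indicator 1 (hyperRefl n t y)) * K (x - y) +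
  (A.indicator 1 x * B.indicator 1 (hyperRefl n t y) +
    A.indicator 1 (hyperRefl n t x) * B.indicator 1 y) * K (x - hyperRefl n t y)

variable {K : E → ℝ≥0∞}

theorem measurable_indicator_one {A : Set E} (hA : MeasurableSet A) :
    Measurable (A.indicator (1 : E → ℝ≥0∞)) := measurable_one.indicator hA

theorem measurable_interaction_integrand (hK : Measurable K) {A B : Set E} (hA : MeasurableSet A)
    (hB : MeasurableSet B) : Measurable fun p : E × E =>
      A.indicator (1 : E → ℝ≥0∞) p.1 * B.indicator (1 : E → ℝ≥0∞) p.2 * K (p.1 - p.2) := by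
  have := measurable_indicator_one hA
  have := measurable_indicator_one hB
  fun_prop

theorem measurable_mirrorSum (hK : Measurable K) {n : E} {t : ℝ} {A B : Set E}
    (hA : MeasurableSet A) (hB : MeasurableSet B) :
    Measurable fun p : E × E => mirrorSum K n t A B p.1 p.2 := by
  have := measurable_indicator_one hA
  have := measurable_indicator_one hB
  have := (continuous_hyperRefl n t).measurable
  unfold mirrorSum
  fun_prop

theorem lintegral_lintegral_add_four {f₁ f₂ f₃ f₄ : E → E → ℝ≥0∞}
    (h₁ : Measurable fun p : E × E => f₁ p.1 p.2) (h₂ : Measurable fun p : E × E => f₂ p.1 p.2)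
    (h₃ : Measurable fun p : E × E => f₃ p.1 p.2) (h₄ : Measurable fun p : E × E => f₄ p.1 p.2) :
    ∫⁻ x, ∫⁻ y, (f₁ x y + f₂ x y + (f₃ x y + f₄ x y)) =
      (∫⁻ x, ∫⁻ y, f₁ x y) + (∫⁻ x, ∫⁻ y, f₂ x y) +
        ((∫⁻ x, ∫⁻ y, f₃ x y) + ∫⁻ x, ∫⁻ y, f₄ x y) := by
  rw [lintegral_lintegral h₁.aemeasurable, lintegral_lintegral h₂.aemeasurable,
    lintegral_lintegral h₃.aemeasurable, lintegral_lintegral h₄.aemeasurable,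
    ← lintegral_add_left h₁, ← lintegral_add_left h₃]
  refine Eq.trans ?_ (lintegral_add_left (h₁.add h₂) _)
  exact lintegral_lintegral (f := fun x y => f₁ x y + f₂ x y + (f₃ x y + f₄ x y))
    ((h₁.add h₂).add (h₃.add h₄)).aemeasurable

/-- Reflecting `x`, `y` or both preserves the measure, and the kernel sees only distances, so each
of the four terms integrates to the interaction. Interactions can then be compared pointwise through
`mirrorSum`. -/
theorem lintegral_mirrorSum (hK : IsRadialKernel K) {n : E} (hn : ‖n‖ = 1) (t : ℝ) {A B : Set E}
    (hA : MeasurableSet A) (hB : MeasurableSet B) :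
    ∫⁻ x, ∫⁻ y, mirrorSum K n t A B x y = 4 * interaction K A B := by
  have mA := measurable_indicator_one hA
  have mB := measurable_indicator_one hB
  have mr := (continuous_hyperRefl n t).measurable
  have mK := hK.measurable
  have h2 : ∫⁻ x, ∫⁻ y, A.indicator (1 : E → ℝ≥0∞) (hyperRefl n t x) *
      B.indicator (1 : E → ℝ≥0∞) (hyperRefl n t y) * K (x - y) = interaction K A B := by
    have : ∀ x y, K (hyperRefl n t x - hyperRefl n t y) = K (x - y) := fun x y =>
      hK.congr_norm (norm_hyperRefl_sub_hyperRefl hn t x y)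
    refine (lintegral_congr fun x => lintegral_congr fun y => by rw [← this x y]).trans ?_
    rw [lintegral_comp_hyperRefl hn t (fun x => ∫⁻ y, A.indicator (1 : E → ℝ≥0∞) x *
      B.indicator (1 : E → ℝ≥0∞) (hyperRefl n t y) * K (x - hyperRefl n t y))]
    refine lintegral_congr fun x => ?_
    exact lintegral_comp_hyperRefl hn t (fun y => A.indicator (1 : E → ℝ≥0∞) x *
      B.indicator (1 : E → ℝ≥0∞) y * K (x - y))
  have h3 : ∫⁻ x, ∫⁻ y, A.indicator (1 : E → ℝ≥0∞) x *
      B.indicator (1 : E → ℝ≥0∞) (hyperRefl n t y) * K (x - hyperRefl n t y) =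
      interaction K A B := by
    refine lintegral_congr fun x => ?_
    exact lintegral_comp_hyperRefl hn t (fun y => A.indicator (1 : E → ℝ≥0∞) x *
      B.indicator (1 : E → ℝ≥0∞) y * K (x - y))
  have h4 : ∫⁻ x, ∫⁻ y, A.indicator (1 : E → ℝ≥0∞) (hyperRefl n t x) *
      B.indicator (1 : E → ℝ≥0∞) y * K (x - hyperRefl n t y) = interaction K A B := by
    have : ∀ x y, K (x - hyperRefl n t y) = K (hyperRefl n t x - y) := fun x y =>
      hK.congr_norm (norm_hyperRefl_sub hn t x y).symm
    simp_rw [this]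
    exact lintegral_comp_hyperRefl hn t (fun x => ∫⁻ y, A.indicator (1 : E → ℝ≥0∞) x *
      B.indicator (1 : E → ℝ≥0∞) y * K (x - y))
  simp only [mirrorSum, add_mul]
  have m1 : Measurable fun p : E × E => A.indicator (1 : E → ℝ≥0∞) p.1 *
      B.indicator (1 : E → ℝ≥0∞) p.2 * K (p.1 - p.2) := by fun_prop
  have m2 : Measurable fun p : E × E => A.indicator (1 : E → ℝ≥0∞) (hyperRefl n t p.1) *
      B.indicator (1 : E → ℝ≥0∞) (hyperRefl n t p.2) * K (p.1 - p.2) := by fun_prop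
  have m3 : Measurable fun p : E × E => A.indicator (1 : E → ℝ≥0∞) p.1 *
      B.indicator (1 : E → ℝ≥0∞) (hyperRefl n t p.2) * K (p.1 - hyperRefl n t p.2) := by fun_prop
  have m4 : Measurable fun p : E × E => A.indicator (1 : E → ℝ≥0∞) (hyperRefl n t p.1) *
      B.indicator (1 : E → ℝ≥0∞) p.2 * K (p.1 - hyperRefl n t p.2) := by fun_prop
  rw [lintegral_lintegral_add_four m1 m2 m3 m4, h2, h3, h4]
  change interaction K A B + _ + _ = _
  ring

theorem indicator_polarization_of_nonneg {n : E} (hn : ‖n‖ = 1) {t : ℝ} (A : Set E) {x : E}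
    (h : 0 ≤ height n t x) :
    (polarization n t A).indicator (1 : E → ℝ≥0∞) x =
        max (A.indicator 1 x) (A.indicator 1 (hyperRefl n t x)) ∧
      (polarization n t A).indicator (1 : E → ℝ≥0∞) (hyperRefl n t x) =
        min (A.indicator 1 x) (A.indicator 1 (hyperRefl n t x)) := by
  rcases h.eq_or_lt with h0 | h0
  · have hx : hyperRefl n t x = x := by simp [hyperRefl, ← h0]
    by_cases hA : x ∈ A <;> simp [polarization, indicator, hx, hA, ← h0]
  · have h1 : ¬ height n t x < 0 := not_lt.2 h
    by_cases hA : x ∈ A <;> by_cases hA' : hyperRefl n t x ∈ A <;>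
      simp [polarization, indicator, hA, hA', h, h1, h0, height_hyperRefl hn,
        hyperRefl_hyperRefl hn, not_le.2 h0]

theorem indicator_polarization_of_nonpos {n : E} (hn : ‖n‖ = 1) {t : ℝ} (A : Set E) {x : E}
    (h : height n t x ≤ 0) :
    (polarization n t A).indicator (1 : E → ℝ≥0∞) x =
        min (A.indicator 1 x) (A.indicator 1 (hyperRefl n t x)) ∧
      (polarization n t A).indicator (1 : E → ℝ≥0∞) (hyperRefl n t x) =
        max (A.indicator 1 x) (A.indicator 1 (hyperRefl n t x)) := by
  have := indicator_polarization_of_nonneg hn (t := t) A (x := hyperRefl n t x)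
    (by rw [height_hyperRefl hn]; linarith)
  rw [hyperRefl_hyperRefl hn] at this
  exact ⟨this.2.trans (min_comm _ _), this.1.trans (max_comm _ _)⟩

/-- The coefficients of `k` and `l` add up to `(a + a') * (b + b')` on both sides. Pairing large
with large puts as much as possible on the larger weight `k`. -/
theorem rearrangement_zero_one {a a' b b' : ℝ≥0∞} (ha : a = 0 ∨ a = 1) (ha' : a' = 0 ∨ a' = 1)
    (hb : b = 0 ∨ b = 1) (hb' : b' = 0 ∨ b' = 1) {k l : ℝ≥0∞} (h : l ≤ k) :
    (a * b + a' * b') * k + (a * b' + a' * b) * l ≤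
      (max a a' * max b b' + min a a' * min b b') * k +
      (max a a' * min b b' + min a a' * max b b') * l := by
  rcases ha with rfl | rfl <;> rcases ha' with rfl | rfl <;> rcases hb with rfl | rfl <;>
    rcases hb' with rfl | rfl <;> simp [h]

theorem indicator_one_eq_zero_or_one (A : Set E) (x : E) :
    A.indicator (1 : E → ℝ≥0∞) x = 0 ∨ A.indicator (1 : E → ℝ≥0∞) x = 1 := by
  by_cases h : x ∈ A <;> simp [h]

/-- If `x` and `y` are on the same side, `x` is nearer to `y` than to its mirror image. On opposite
sides `y` and its image exchange roles, which gives the four cases. -/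
theorem mirrorSum_le_mirrorSum_polarization (hK : IsRadialKernel K) {n : E} (hn : ‖n‖ = 1) (t : ℝ)
    (A B : Set E) (x y : E) :
    mirrorSum K n t A B x y ≤
      mirrorSum K n t (polarization n t A) (polarization n t B) x y := by
  have ha := indicator_one_eq_zero_or_one A x
  have ha' := indicator_one_eq_zero_or_one A (hyperRefl n t x)
  have hb := indicator_one_eq_zero_or_one B y
  have hb' := indicator_one_eq_zero_or_one B (hyperRefl n t y)
  unfold mirrorSum
  rcases le_total 0 (height n t x) with hx | hx <;> rcases le_total 0 (height n t y) with hy | hy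
  · rw [(indicator_polarization_of_nonneg hn A hx).1, (indicator_polarization_of_nonneg hn A hx).2,
      (indicator_polarization_of_nonneg hn B hy).1, (indicator_polarization_of_nonneg hn B hy).2]
    exact rearrangement_zero_one ha ha' hb hb'
      (hK.anti _ _ (norm_sub_le_norm_sub_hyperRefl hn t (mul_nonneg hx hy)))
  · rw [(indicator_polarization_of_nonneg hn A hx).1, (indicator_polarization_of_nonneg hn A hx).2,
      (indicator_polarization_of_nonpos hn B hy).1, (indicator_polarization_of_nonpos hn B hy).2]
    have := rearrangement_zero_one ha ha' hb' hb
      (hK.anti _ _ (norm_sub_hyperRefl_le_norm_sub hn t (mul_nonpos_of_nonneg_of_nonpos hx hy)))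
    rw [max_comm (B.indicator _ _), min_comm (B.indicator _ _)] at this
    rw [add_comm] at this
    exact this.trans_eq (add_comm _ _)
  · rw [(indicator_polarization_of_nonpos hn A hx).1, (indicator_polarization_of_nonpos hn A hx).2,
      (indicator_polarization_of_nonneg hn B hy).1, (indicator_polarization_of_nonneg hn B hy).2]
    have := rearrangement_zero_one ha ha' hb' hb
      (hK.anti _ _ (norm_sub_hyperRefl_le_norm_sub hn t (mul_nonpos_of_nonpos_of_nonneg hx hy)))
    rw [max_comm (B.indicator _ _), min_comm (B.indicator _ _)] at this
    rw [add_comm] at this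
    refine this.trans_eq ?_
    ring
  · rw [(indicator_polarization_of_nonpos hn A hx).1, (indicator_polarization_of_nonpos hn A hx).2,
      (indicator_polarization_of_nonpos hn B hy).1, (indicator_polarization_of_nonpos hn B hy).2]
    have := rearrangement_zero_one ha ha' hb hb'
      (hK.anti _ _ (norm_sub_le_norm_sub_hyperRefl hn t (mul_nonneg_of_nonpos_of_nonpos hx hy)))
    refine this.trans_eq ?_
    ring

theorem interaction_le_interaction_polarization (hK : IsRadialKernel K) {n : E} (hn : ‖n‖ = 1)
    (t : ℝ) {A B : Set E} (hA : MeasurableSet A) (hB : MeasurableSet B) :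
    interaction K A B ≤ interaction K (polarization n t A) (polarization n t B) := by
  have h : 4 * interaction K A B ≤
      4 * interaction K (polarization n t A) (polarization n t B) := by
    rw [← lintegral_mirrorSum hK hn t hA hB, ← lintegral_mirrorSum hK hn t
      (measurableSet_polarization n t hA) (measurableSet_polarization n t hB)]
    exact lintegral_mono fun x => lintegral_mono fun y =>
      mirrorSum_le_mirrorSum_polarization hK hn t A B x y
  exact (ENNReal.mul_le_mul_iff_right (by norm_num) (by norm_num)).1 h

/-- The points on the positive side that belong to `A` while their mirror images do not. -/
def gainSet (n : E) (t : ℝ) (A : Set E) : Set E :=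
  {x | 0 < height n t x ∧ x ∈ A ∧ hyperRefl n t x ∉ A}

/-- The points on the positive side that do not belong to `A` while their mirror images do. -/
def lossSet (n : E) (t : ℝ) (A : Set E) : Set E :=
  {x | 0 < height n t x ∧ x ∉ A ∧ hyperRefl n t x ∈ A}

theorem measurableSet_gainSet (n : E) (t : ℝ) {A : Set E} (hA : MeasurableSet A) :
    MeasurableSet (gainSet n t A) :=
  (measurableSet_lt measurable_const (continuous_height n t).measurable).inter
    (hA.inter ((continuous_hyperRefl n t).measurable hA).compl)

theorem interaction_le (hK : IsRadialKernel K) {A B : Set E} (hA : MeasurableSet A) :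
    interaction K A B ≤ volume A * ∫⁻ x, K x := by
  calc interaction K A B ≤ ∫⁻ x, A.indicator 1 x * ∫⁻ y, K y := by
        refine lintegral_mono fun x => ?_
        have h1 : ∀ y, K (x - y) = K (y - x) := fun y => hK.congr_norm (norm_sub_rev _ _)
        rw [← lintegral_sub_right_eq_self K x]
        rcases indicator_one_eq_zero_or_one A x with h | h
        · simp [h]
        · simp only [h, one_mul, h1]
          refine lintegral_mono fun y => ?_
          rcases indicator_one_eq_zero_or_one B y with h | h <;> simp [h]
    _ = volume A * ∫⁻ x, K x := by
        rw [lintegral_mul_const _ (measurable_indicator_one hA), lintegral_indicator_one hA]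

theorem interaction_ne_top (hK : IsRadialKernel K) {A B : Set E} (hA : MeasurableSet A)
    (hAf : volume A ≠ ∞) : interaction K A B ≠ ∞ :=
  ((interaction_le hK hA).trans_lt
    (ENNReal.mul_lt_top hAf.lt_top hK.lintegral_ne_top.lt_top)).ne

/-- For a strictly decreasing kernel the polarization inequality is strict unless the sets are
ordered in the same way on the two sides of the hyperplane. -/
theorem volume_gainSet_eq_zero_or (hK : IsRadialKernel K) (hKs : ∀ x y, ‖x‖ < ‖y‖ → K y < K x)
    {n : E} (hn : ‖n‖ = 1) (t : ℝ) {A B : Set E} (hA : MeasurableSet A) (hB : MeasurableSet B)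
    (hAf : volume A ≠ ∞)
    (h : interaction K (polarization n t A) (polarization n t B) ≤ interaction K A B) :
    volume (gainSet n t A) = 0 ∨ volume (lossSet n t B) = 0 := by
  have mA := measurableSet_polarization n t hA
  have mB := measurableSet_polarization n t hB
  -- A pointwise inequality between functions with the same finite integral is an equality almost
  -- everywhere.
  have key : (fun p : E × E => mirrorSum K n t A B p.1 p.2) =ᵐ[volume.prod volume]
      fun p => mirrorSum K n t (polarization n t A) (polarization n t B) p.1 p.2 := by
    refine ae_eq_of_ae_le_of_lintegral_le (.of_forall fun p =>
      mirrorSum_le_mirrorSum_polarization hK hn t A B p.1 p.2) ?_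
      (measurable_mirrorSum hK.measurable mA mB).aemeasurable ?_
    · rw [lintegral_prod _ (measurable_mirrorSum hK.measurable hA hB).aemeasurable,
        lintegral_mirrorSum hK hn t hA hB]
      exact ENNReal.mul_ne_top (by norm_num) (interaction_ne_top hK hA hAf)
    · rw [lintegral_prod _ (measurable_mirrorSum hK.measurable hA hB).aemeasurable,
        lintegral_mirrorSum hK hn t hA hB,
        lintegral_prod _ (measurable_mirrorSum hK.measurable mA mB).aemeasurable,
        lintegral_mirrorSum hK hn t mA mB]
      gcongr
  -- On this product the density rises strictly, from `K (x - hyperRefl n t y)` to `K (x - y)`, so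
  -- the product must be null.
  have hnull : volume.prod volume (gainSet n t A ×ˢ lossSet n t B) = 0 := by
    refine measure_mono_null ?_ (ae_iff.1 key)
    rintro ⟨x, y⟩ ⟨⟨hx, hxA, hxA'⟩, hy, hyB, hyB'⟩
    simp only [mem_ofPred_eq]
    refine ne_of_lt ?_
    simp only at hx hxA hxA' hy hyB hyB'
    unfold mirrorSum
    rw [(indicator_polarization_of_nonneg hn A hx.le).1,
      (indicator_polarization_of_nonneg hn A hx.le).2,
      (indicator_polarization_of_nonneg hn B hy.le).1,
      (indicator_polarization_of_nonneg hn B hy.le).2]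
    simp only [indicator_of_mem hxA, indicator_of_notMem hxA', indicator_of_notMem hyB,
      indicator_of_mem hyB', Pi.one_apply]
    simpa using hKs _ _ (norm_sub_lt_norm_sub_hyperRefl hn t (mul_pos hx hy))
  rw [Measure.prod_prod] at hnull
  exact mul_eq_zero.1 hnull

end TwoPoint

/-! ### Averaging over all hyperplanes -/

section Pigeonhole

variable {E : Type*} [NormedAddCommGroup E] [InnerProductSpace ℝ E] [FiniteDimensional ℝ E]
  [MeasurableSpace E] [BorelSpace E]

/-- Polar coordinates, as an upper bound for a function supported in a ball. -/
theorem lintegral_le_lintegral_sphere [Nontrivial E] {F : E → ℝ≥0∞} (hF : Measurable F) {ρ : ℝ}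
    (hF0 : ∀ z, ρ ≤ ‖z‖ → F z = 0) :
    ∫⁻ z, F z ≤ ENNReal.ofReal (ρ ^ (Module.finrank ℝ E - 1)) *
      ∫⁻ u, (∫⁻ r : ℝ, F (r • (u : E))) ∂(volume : Measure E).toSphere := by
  have mF : Measurable fun p : Metric.sphere (0 : E) 1 × Ioi (0 : ℝ) =>
      F ((p.2 : ℝ) • (p.1 : E)) := by fun_prop
  have h1 : ∫⁻ z, F z = ∫⁻ u, ∫⁻ r : Ioi (0 : ℝ), F ((r : ℝ) • (u : E))
      ∂Measure.volumeIoiPow (Module.finrank ℝ E - 1) ∂(volume : Measure E).toSphere := by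
    rw [← lintegral_prod (fun p : Metric.sphere (0 : E) 1 × Ioi (0 : ℝ) =>
      F ((p.2 : ℝ) • (p.1 : E))) mF.aemeasurable,
      ← (volume : Measure E).measurePreserving_homeomorphUnitSphereProd.lintegral_comp_emb
        (Homeomorph.measurableEmbedding _)]
    calc ∫⁻ z, F z = ∫⁻ z : ({0}ᶜ : Set E), F z ∂((volume : Measure E).comap (↑)) := by
          rw [lintegral_subtype_comap (measurableSet_singleton _).compl, restrict_compl_singleton]
      _ = _ := by
          refine lintegral_congr fun z => ?_
          have : ‖(z : E)‖ ≠ 0 := norm_ne_zero_iff.2 z.2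
          simp [smul_smul, this]
  rw [h1, ← lintegral_const_mul' _ _ ENNReal.ofReal_ne_top]
  refine lintegral_mono fun u => ?_
  have mu : Measurable fun r : Ioi (0 : ℝ) => F ((r : ℝ) • (u : E)) := by fun_prop
  calc ∫⁻ r : Ioi (0 : ℝ), F ((r : ℝ) • (u : E)) ∂Measure.volumeIoiPow (Module.finrank ℝ E - 1)
      = ∫⁻ r : Ioi (0 : ℝ), ENNReal.ofReal ((r : ℝ) ^ (Module.finrank ℝ E - 1)) *
          F ((r : ℝ) • (u : E)) ∂(volume.comap Subtype.val) := by
        rw [Measure.volumeIoiPow, lintegral_withDensity_eq_lintegral_mul _ (by fun_prop) mu]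
        rfl
    _ ≤ ∫⁻ r : Ioi (0 : ℝ), ENNReal.ofReal (ρ ^ (Module.finrank ℝ E - 1)) *
          F ((r : ℝ) • (u : E)) ∂(volume.comap Subtype.val) := by
        refine lintegral_mono fun r => ?_
        have hr : (0 : ℝ) < r := r.2
        rcases le_total ρ r with h | h
        · have : F ((r : ℝ) • (u : E)) = 0 := hF0 _ (by
            rw [norm_smul, norm_eq_of_mem_sphere, mul_one, Real.norm_of_nonneg hr.le]
            exact h)
          simp [this]
        · gcongr
    _ = ENNReal.ofReal (ρ ^ (Module.finrank ℝ E - 1)) *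
          ∫⁻ r in Ioi (0 : ℝ), F (r • (u : E)) := by
        rw [lintegral_const_mul' _ _ ENNReal.ofReal_ne_top,
          lintegral_subtype_comap measurableSet_Ioi (fun r : ℝ => F (r • (u : E)))]
    _ ≤ _ := by
        gcongr
        -- Passing to the whole line only costs a constant, and makes the radial integral invariant
        -- under translation.
        exact Measure.restrict_le_self

/-- For fixed `x`, the image of `x` under the reflection `(u, t)` is `x + r • u` with `r = t - 2⟪u,
x⟫`: the reflections parametrize space by polar coordinates around `x`. Points of the ball have
distance below `2 * R`, which bounds the Jacobian. Integration over `x ∈ P` and Tonelli finish the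
argument. -/
theorem volume_mul_volume_le_lintegral_hyperRefl [Nontrivial E] {R : ℝ} {P Q : Set E}
    (hP : MeasurableSet P) (hQ : MeasurableSet Q) (hPR : P ⊆ Metric.ball 0 R)
    (hQR : Q ⊆ Metric.ball 0 R) :
    volume P * volume Q ≤ ENNReal.ofReal ((2 * R) ^ (Module.finrank ℝ E - 1)) *
      ∫⁻ u, (∫⁻ t : ℝ, volume {x | x ∈ P ∧ hyperRefl (u : E) t x ∈ Q})
        ∂(volume : Measure E).toSphere := by
  have mP := measurable_indicator_one hP
  have mQ := measurable_indicator_one hQ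
  set c := ENNReal.ofReal ((2 * R) ^ (Module.finrank ℝ E - 1)) with hc
  have mr : Measurable fun q : E × (Metric.sphere (0 : E) 1 × ℝ) =>
      hyperRefl (q.2.1 : E) q.2.2 q.1 := by
    unfold hyperRefl height
    have : Continuous fun q : E × (Metric.sphere (0 : E) 1 × ℝ) =>
      q.1 - (2 * inner ℝ (q.2.1 : E) q.1 - q.2.2) • (q.2.1 : E) := by fun_prop
    exact this.measurable
  have mF : Measurable fun q : E × (Metric.sphere (0 : E) 1 × ℝ) =>
      P.indicator (1 : E → ℝ≥0∞) q.1 *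
        Q.indicator (1 : E → ℝ≥0∞) (hyperRefl (q.2.1 : E) q.2.2 q.1) := by fun_prop
  have h1 : ∀ x ∈ P, volume Q ≤ c * ∫⁻ u, (∫⁻ t : ℝ,
      Q.indicator (1 : E → ℝ≥0∞) (hyperRefl (u : E) t x)) ∂(volume : Measure E).toSphere := by
    intro x hx
    calc volume Q = ∫⁻ z, Q.indicator (1 : E → ℝ≥0∞) (x + z) := by
          rw [lintegral_add_left_eq_self (Q.indicator (1 : E → ℝ≥0∞)), lintegral_indicator_one hQ]
      _ ≤ c * ∫⁻ u, (∫⁻ r : ℝ, Q.indicator (1 : E → ℝ≥0∞) (x + r • (u : E)))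
            ∂(volume : Measure E).toSphere := by
          refine lintegral_le_lintegral_sphere (by fun_prop) fun z hz => ?_
          refine indicator_of_notMem (fun hxz => ?_) _
          have h1 := mem_ball_zero_iff.1 (hPR hx)
          have h2 := mem_ball_zero_iff.1 (hQR hxz)
          have h3 := norm_sub_le (x + z) x
          rw [add_sub_cancel_left] at h3
          linarith
      _ = _ := by
          congr 1
          refine lintegral_congr fun u => ?_
          rw [← lintegral_sub_right_eq_self _ (2 * inner ℝ (u : E) x)]
          refine lintegral_congr fun t => ?_
          congr 1
          simp only [hyperRefl, height, sub_smul]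
          abel
  calc volume P * volume Q = ∫⁻ x, P.indicator 1 x * volume Q := by
        rw [lintegral_mul_const _ mP, lintegral_indicator_one hP]
    _ ≤ ∫⁻ x, c * ∫⁻ w : Metric.sphere (0 : E) 1 × ℝ, P.indicator (1 : E → ℝ≥0∞) x *
          Q.indicator (1 : E → ℝ≥0∞) (hyperRefl (w.1 : E) w.2 x)
          ∂((volume : Measure E).toSphere.prod volume) := by
        refine lintegral_mono fun x => ?_
        by_cases hx : x ∈ P
        · simp only [indicator_of_mem hx, Pi.one_apply, one_mul]
          refine (h1 x hx).trans_eq ?_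
          rw [lintegral_prod]
          exact (mQ.comp (mr.comp measurable_prodMk_left)).aemeasurable
        · simp [hx]
    _ = c * ∫⁻ w : Metric.sphere (0 : E) 1 × ℝ, volume {x | x ∈ P ∧ hyperRefl (w.1 : E) w.2 x ∈ Q}
          ∂((volume : Measure E).toSphere.prod volume) := by
        rw [lintegral_const_mul' _ _ ENNReal.ofReal_ne_top,
          lintegral_lintegral_swap mF.aemeasurable]
        congr 1
        refine lintegral_congr fun w => ?_
        have hm : MeasurableSet {x | x ∈ P ∧ hyperRefl (w.1 : E) w.2 x ∈ Q} :=
          hP.inter ((continuous_hyperRefl _ _).measurable hQ)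
        rw [← lintegral_indicator_one hm]
        refine lintegral_congr fun x => ?_
        by_cases hx : x ∈ P <;> by_cases hy : hyperRefl (w.1 : E) w.2 x ∈ Q <;>
          simp [indicator, hx, hy]
    _ = _ := by
        rw [lintegral_prod]
        have mS : MeasurableSet {q : (Metric.sphere (0 : E) 1 × ℝ) × E |
            q.2 ∈ P ∧ hyperRefl (q.1.1 : E) q.1.2 q.2 ∈ Q} :=
          (measurable_snd hP).inter ((mr.comp measurable_swap) hQ)
        exact (measurable_measure_prodMk_left mS).aemeasurable

/-- Two sets in a ball are matched by some reflection on a portion of definite measure. -/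
theorem exists_hyperRefl_volume_ge [Nontrivial E] (R : ℝ) :
    ∃ C : ℝ≥0∞, C ≠ 0 ∧ C ≠ ∞ ∧ ∀ P Q : Set E, MeasurableSet P → MeasurableSet Q →
      P ⊆ Metric.ball 0 R → Q ⊆ Metric.ball 0 R →
      ∃ (n : E) (t : ℝ), ‖n‖ = 1 ∧
        volume P * volume Q ≤ C * volume {x | x ∈ P ∧ hyperRefl n t x ∈ Q} := by
  set c := ENNReal.ofReal ((2 * R) ^ (Module.finrank ℝ E - 1)) with hc
  set S := (volume : Measure E).toSphere univ with hS
  -- The Jacobian bound times the total measure of the relevant parameters: directions on the sphere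
  -- and `t` in an interval of length `4 * R`.
  set C₀ := c * (ENNReal.ofReal (4 * R) * S) with hC₀
  have hC₀t : C₀ ≠ ∞ := ENNReal.mul_ne_top ENNReal.ofReal_ne_top
    (ENNReal.mul_ne_top ENNReal.ofReal_ne_top (measure_ne_top _ _))
  have hCt : C₀ + 1 ≠ ∞ := ENNReal.add_ne_top.2 ⟨hC₀t, ENNReal.one_ne_top⟩
  -- Adding one makes the constant nonzero and the final averaging estimate strict.
  refine ⟨C₀ + 1, by simp, hCt, fun P Q hP hQ hPR hQR => ?_⟩
  obtain ⟨n₀, hn₀⟩ := exists_norm_eq E zero_le_one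
  by_contra! hcon
  have hb : ∀ A ⊆ Metric.ball (0 : E) R, volume A ≠ ∞ := fun A hA =>
    ((measure_mono hA).trans_lt measure_ball_lt_top).ne
  set V := volume P * volume Q with hV
  have hVt : V ≠ ∞ := ENNReal.mul_ne_top (hb P hPR) (hb Q hQR)
  have hV0 : V ≠ 0 := fun h => by simpa [h] using hcon n₀ 0 hn₀
  have hle : ∀ (u : Metric.sphere (0 : E) 1) (t : ℝ),
      volume {x | x ∈ P ∧ hyperRefl (u : E) t x ∈ Q} ≤
        (Icc (-(2 * R)) (2 * R)).indicator (fun _ => V / (C₀ + 1)) t := by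
    intro u t
    have hu : ‖(u : E)‖ = 1 := norm_eq_of_mem_sphere u
    by_cases ht : t ∈ Icc (-(2 * R)) (2 * R)
    · rw [indicator_of_mem ht, ENNReal.le_div_iff_mul_le (.inl (by simp)) (.inl hCt), mul_comm]
      exact (hcon u t hu).le
    · have : {x | x ∈ P ∧ hyperRefl (u : E) t x ∈ Q} = ∅ := by
        refine eq_empty_of_forall_notMem fun x hx => ht ?_
        have h1 := mem_ball_zero_iff.1 (hPR hx.1)
        have h2 := mem_ball_zero_iff.1 (hQR hx.2)
        -- A point and its image have inner products with `u` adding up to `t`, so both can lie in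
        -- the ball only if `|t| ≤ 2 * R`.
        have h3 : t = inner ℝ (u : E) x + inner ℝ (u : E) (hyperRefl (u : E) t x) := by
          simp only [hyperRefl, height, inner_sub_right, inner_smul_right,
            real_inner_self_eq_norm_sq, hu]
          ring
        have h4 := abs_real_inner_le_norm (u : E) x
        have h5 := abs_real_inner_le_norm (u : E) (hyperRefl (u : E) t x)
        rw [hu, one_mul] at h4 h5
        rw [abs_le] at h4 h5
        constructor <;> linarith [h4.1, h4.2, h5.1, h5.2]
      rw [this]; simp
  have h1 : V ≤ C₀ * (V / (C₀ + 1)) := by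
    calc V ≤ c * ∫⁻ u, (∫⁻ t : ℝ, volume {x | x ∈ P ∧ hyperRefl (u : E) t x ∈ Q})
          ∂(volume : Measure E).toSphere :=
        volume_mul_volume_le_lintegral_hyperRefl hP hQ hPR hQR
      _ ≤ c * ∫⁻ _ : Metric.sphere (0 : E) 1, (∫⁻ t : ℝ,
          (Icc (-(2 * R)) (2 * R)).indicator (fun _ => V / (C₀ + 1)) t)
          ∂(volume : Measure E).toSphere := by
        gcongr with u t
        exact hle u t
      _ = C₀ * (V / (C₀ + 1)) := by
        rw [lintegral_indicator measurableSet_Icc, setLIntegral_const, lintegral_const,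
          Real.volume_Icc, hC₀, ← hS]
        ring_nf
  have h2 : C₀ * (V / (C₀ + 1)) < V := by
    have h0 : V / (C₀ + 1) ≠ 0 := ENNReal.div_ne_zero.2 ⟨hV0, hCt⟩
    have ht : V / (C₀ + 1) ≠ ∞ := ENNReal.div_ne_top hVt (by simp)
    calc C₀ * (V / (C₀ + 1)) < C₀ * (V / (C₀ + 1)) + V / (C₀ + 1) :=
          ENNReal.lt_add_right (ENNReal.mul_ne_top hC₀t ht) h0
      _ = (C₀ + 1) * (V / (C₀ + 1)) := by ring
      _ = V := ENNReal.mul_div_cancel (by simp) hCt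
  exact absurd h1 (not_le.2 h2)

end Pigeonhole

/-! ### Riesz's inequality for sets -/

section Riesz

variable {E : Type*} [NormedAddCommGroup E] [InnerProductSpace ℝ E] [FiniteDimensional ℝ E]
  [MeasurableSpace E] [BorelSpace E] {K : E → ℝ≥0∞}

theorem mem_polarization_of_nonneg {n : E} (hn : ‖n‖ = 1) {t : ℝ} (A : Set E) {x : E}
    (h : 0 ≤ height n t x) :
    (x ∈ polarization n t A ↔ x ∈ A ∨ hyperRefl n t x ∈ A) ∧
      (hyperRefl n t x ∈ polarization n t A ↔ x ∈ A ∧ hyperRefl n t x ∈ A) := by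
  rcases h.eq_or_lt with h0 | h0
  · have hx : hyperRefl n t x = x := by simp [hyperRefl, ← h0]
    simp [polarization, hx, ← h0]
  · simp [polarization, h, h0, not_lt.2 h, height_hyperRefl hn, hyperRefl_hyperRefl hn,
      not_le.2 h0, and_comm]

/-- Written this way, relations between measures can be checked on each pair of mirror points. -/
theorem two_mul_volume {n : E} (hn : ‖n‖ = 1) (t : ℝ) {A : Set E} (hA : MeasurableSet A) :
    2 * volume A = ∫⁻ x, (A.indicator (1 : E → ℝ≥0∞) x + A.indicator 1 (hyperRefl n t x)) := by
  rw [lintegral_add_left (measurable_indicator_one hA),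
    lintegral_comp_hyperRefl hn t (A.indicator (1 : E → ℝ≥0∞)), lintegral_indicator_one hA, two_mul]

theorem forall_of_forall_height_nonneg {n : E} (hn : ‖n‖ = 1) (t : ℝ) {p : E → E → Prop}
    (hp : ∀ x y, p x y → p y x) (h : ∀ x, 0 ≤ height n t x → p x (hyperRefl n t x)) (x : E) :
    p x (hyperRefl n t x) := by
  rcases le_total 0 (height n t x) with hx | hx
  · exact h x hx
  · have := h (hyperRefl n t x) (by rw [height_hyperRefl hn]; linarith)
    rw [hyperRefl_hyperRefl hn] at this
    exact hp _ _ this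

theorem volume_polarization {n : E} (hn : ‖n‖ = 1) (t : ℝ) {A : Set E} (hA : MeasurableSet A) :
    volume (polarization n t A) = volume A := by
  have h : 2 * volume (polarization n t A) = 2 * volume A := by
    rw [two_mul_volume hn t hA, two_mul_volume hn t (measurableSet_polarization n t hA)]
    refine lintegral_congr fun x => ?_
    refine forall_of_forall_height_nonneg hn t (p := fun x y =>
      (polarization n t A).indicator (1 : E → ℝ≥0∞) x + (polarization n t A).indicator 1 y =
        A.indicator 1 x + A.indicator 1 y) (fun x y h => by rw [add_comm, h, add_comm])
      (fun x hx => ?_) x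
    obtain ⟨h1, h2⟩ := mem_polarization_of_nonneg hn A hx
    by_cases ha : x ∈ A <;> by_cases hb : hyperRefl n t x ∈ A <;>
      simp [indicator, h1, h2, ha, hb]
  exact (ENNReal.mul_right_inj (by norm_num) (by norm_num)).1 h

/-- The origin has height `-t`, so `t ≤ 0` puts it on the nonnegative side, together with `x`. -/
theorem norm_le_norm_hyperRefl {n : E} (hn : ‖n‖ = 1) {t : ℝ} (ht : t ≤ 0) {x : E}
    (hx : 0 ≤ height n t x) : ‖x‖ ≤ ‖hyperRefl n t x‖ := by
  have := norm_sub_le_norm_sub_hyperRefl hn t (x := 0) (y := x)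
    (mul_nonneg (by simp [height, ht]) hx)
  simpa using this

theorem polarization_subset_ball {n : E} (hn : ‖n‖ = 1) {t : ℝ} (ht : t ≤ 0) {A : Set E} {R : ℝ}
    (hA : A ⊆ Metric.ball 0 R) : polarization n t A ⊆ Metric.ball 0 R := by
  rintro x (⟨hx, h | h⟩ | ⟨-, h, -⟩)
  · exact hA h
  · exact mem_ball_zero_iff.2
      ((norm_le_norm_hyperRefl hn ht hx).trans_lt (mem_ball_zero_iff.1 (hA h)))
  · exact hA h

/-- Polarization with respect to a half-space containing the origin moves mass into a centered
ball. -/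
theorem volume_polarization_diff_ball_add_le {n : E} (hn : ‖n‖ = 1) {t : ℝ} (ht : t ≤ 0) {A : Set E}
    (hA : MeasurableSet A) (r : ℝ) :
    volume (polarization n t A \ Metric.ball 0 r) +
      volume {x | x ∈ A \ Metric.ball 0 r ∧ hyperRefl n t x ∈ Metric.ball 0 r \ A} ≤
        volume (A \ Metric.ball 0 r) := by
  have mC : MeasurableSet (Metric.ball (0 : E) r) := measurableSet_ball
  have mG : MeasurableSet {x | x ∈ A \ Metric.ball 0 r ∧ hyperRefl n t x ∈ Metric.ball 0 r \ A} :=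
    (hA.diff mC).inter ((continuous_hyperRefl n t).measurable (mC.diff hA))
  have mP := (measurableSet_polarization n t hA).diff mC
  have m : Measurable fun x => (polarization n t A \ Metric.ball 0 r).indicator (1 : E → ℝ≥0∞) x +
      (polarization n t A \ Metric.ball 0 r).indicator 1 (hyperRefl n t x) :=
    (measurable_indicator_one mP).add
      ((measurable_indicator_one mP).comp (continuous_hyperRefl n t).measurable)
  have h : 2 * (volume (polarization n t A \ Metric.ball 0 r) +
      volume {x | x ∈ A \ Metric.ball 0 r ∧ hyperRefl n t x ∈ Metric.ball 0 r \ A}) ≤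
        2 * volume (A \ Metric.ball 0 r) := by
    rw [mul_add, two_mul_volume hn t (hA.diff mC), two_mul_volume hn t mP, two_mul_volume hn t mG,
      ← lintegral_add_left m]
    refine lintegral_mono fun x => ?_
    refine forall_of_forall_height_nonneg hn t (p := fun x y =>
      (polarization n t A \ Metric.ball 0 r).indicator (1 : E → ℝ≥0∞) x +
        (polarization n t A \ Metric.ball 0 r).indicator 1 y +
        (Set.indicator {x | x ∈ A \ Metric.ball 0 r ∧ hyperRefl n t x ∈ Metric.ball 0 r \ A} 1 x +
        Set.indicator {x | x ∈ A \ Metric.ball 0 r ∧ hyperRefl n t x ∈ Metric.ball 0 r \ A} 1 y) ≤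
        (A \ Metric.ball 0 r).indicator 1 x + (A \ Metric.ball 0 r).indicator 1 y)
      (fun x y h => by
        rw [add_comm (indicator _ _ y), add_comm (indicator _ _ y), add_comm (indicator _ _ y)]
        exact h)
      (fun x hx => ?_) x
    obtain ⟨h1, h2⟩ := mem_polarization_of_nonneg hn A hx
    -- The only geometric input: the centered ball contains the nearer point of a pair whenever it
    -- contains the farther one. The rest is a finite check.
    have h3 : hyperRefl n t x ∈ Metric.ball 0 r → x ∈ Metric.ball 0 r := fun h =>
      mem_ball_zero_iff.2 ((norm_le_norm_hyperRefl hn ht hx).trans_lt (mem_ball_zero_iff.1 h))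
    generalize Metric.ball (0 : E) r = C at h3 ⊢
    by_cases ha : x ∈ A <;> by_cases hb : hyperRefl n t x ∈ A <;>
      by_cases hc : x ∈ C <;> by_cases hd : hyperRefl n t x ∈ C <;>
      first | exact absurd (h3 hd) hc | simp [indicator, h1, h2, hyperRefl_hyperRefl hn, ha, hb, hc, hd]
  exact (ENNReal.mul_le_mul_iff_right (by norm_num) (by norm_num)).1 h

theorem interaction_comm (hK : IsRadialKernel K) {A B : Set E} (hA : MeasurableSet A)
    (hB : MeasurableSet B) : interaction K A B = interaction K B A := by
  unfold interaction
  rw [lintegral_lintegral_swap (measurable_interaction_integrand hK.measurable hA hB).aemeasurable]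
  refine lintegral_congr fun y => lintegral_congr fun x => ?_
  rw [hK.congr_norm (norm_sub_rev x y), mul_comm (A.indicator _ _)]

theorem interaction_le_add_left (hK : IsRadialKernel K) {A B C : Set E} (hA : MeasurableSet A)
    (hB : MeasurableSet B) (hC : MeasurableSet C) :
    interaction K A B ≤ interaction K C B + volume (A \ C) * ∫⁻ x, K x := by
  calc interaction K A B ≤ interaction K C B + interaction K (A \ C) B := by
        unfold interaction
        rw [← lintegral_add_left
          (measurable_interaction_integrand hK.measurable hC hB).lintegral_prod_right']
        refine lintegral_mono fun x => ?_
        have m : Measurable fun y => C.indicator (1 : E → ℝ≥0∞) x * B.indicator 1 y * K (x - y) :=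
          (measurable_interaction_integrand hK.measurable hC hB).comp measurable_prodMk_left
        change _ ≤ (∫⁻ y, C.indicator 1 x * B.indicator 1 y * K (x - y)) + _
        rw [← lintegral_add_left m]
        refine lintegral_mono fun y => ?_
        by_cases h1 : x ∈ A <;> by_cases h2 : x ∈ C <;> simp [h1, h2]
    _ ≤ _ := by
        gcongr
        exact interaction_le hK (hA.diff hC)

/-- Lipschitz continuity of the interaction, used both to reach the balls in the limit and to remove
truncations. -/
theorem interaction_le_add (hK : IsRadialKernel K) {A B C D : Set E} (hA : MeasurableSet A)
    (hB : MeasurableSet B) (hC : MeasurableSet C) (hD : MeasurableSet D) :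
    interaction K A B ≤
      interaction K C D + (volume (A \ C) + volume (B \ D)) * ∫⁻ x, K x := by
  calc interaction K A B ≤ interaction K B C + volume (A \ C) * ∫⁻ x, K x := by
        rw [interaction_comm hK hB hC]; exact interaction_le_add_left hK hA hB hC
    _ ≤ (interaction K D C + volume (B \ D) * ∫⁻ x, K x) + volume (A \ C) * ∫⁻ x, K x := by
        gcongr
        exact interaction_le_add_left hK hB hC hD
    _ = _ := by rw [interaction_comm hK hD hC]; ring

theorem volume_diff_eq_volume_diff {A C : Set E} (hA : MeasurableSet A) (hC : MeasurableSet C)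
    (h : volume A = volume C) (hf : volume A ≠ ∞) : volume (A \ C) = volume (C \ A) := by
  have h1 := measure_inter_add_sdiff (μ := volume) A hC
  have h2 := measure_inter_add_sdiff (μ := volume) C hA
  rw [inter_comm, ← h, ← h1] at h2
  exact ((ENNReal.add_right_inj (ne_top_of_le_ne_top hf (measure_mono inter_subset_left))).1 h2).symm

/-- `A \ B` and `B \ A`, with `B` the ball, have equal measure `a`. Some reflection carries a part
of the first of measure at least `a ^ 2 / c` into the second. The hyperplane is then oriented so
that the origin is on its nonnegative side. -/
theorem exists_polarization_gain [Nontrivial E] (R : ℝ) :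
    ∃ c : ℝ≥0∞, c ≠ 0 ∧ c ≠ ∞ ∧ ∀ (A : Set E) (r : ℝ), MeasurableSet A → A ⊆ Metric.ball 0 R →
      Metric.ball (0 : E) r ⊆ Metric.ball 0 R → volume A = volume (Metric.ball (0 : E) r) →
      ∃ (n : E) (t : ℝ), ‖n‖ = 1 ∧ t ≤ 0 ∧
        volume (polarization n t A \ Metric.ball 0 r) + volume (A \ Metric.ball 0 r) ^ 2 / c ≤
          volume (A \ Metric.ball 0 r) := by
  obtain ⟨c, hc0, hct, hc⟩ := exists_hyperRefl_volume_ge (E := E) R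
  refine ⟨c, hc0, hct, fun A r hA hAR hr hAr => ?_⟩
  obtain ⟨n, t, hn, h⟩ := hc (A \ Metric.ball 0 r) (Metric.ball 0 r \ A)
    (hA.diff measurableSet_ball) (measurableSet_ball.diff hA) (sdiff_subset.trans hAR)
    (sdiff_subset.trans hr)
  rw [← volume_diff_eq_volume_diff hA measurableSet_ball hAr
    (hAr ▸ measure_ball_lt_top.ne), ← sq] at h
  have h' : volume (A \ Metric.ball 0 r) ^ 2 / c ≤
      volume {x | x ∈ A \ Metric.ball 0 r ∧ hyperRefl n t x ∈ Metric.ball 0 r \ A} :=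
    ENNReal.div_le_of_le_mul (by rwa [mul_comm])
  rcases le_total t 0 with ht | ht
  · exact ⟨n, t, hn, ht, (by gcongr : _ ≤ _).trans
      (volume_polarization_diff_ball_add_le hn ht hA r)⟩
  · refine ⟨-n, -t, by rwa [norm_neg], by linarith, ?_⟩
    simp_rw [← hyperRefl_neg n t] at h'
    exact (by gcongr : _ ≤ _).trans
      (volume_polarization_diff_ball_add_le (by rwa [norm_neg]) (by linarith) hA r)

/-- `S` collects the defects `δ` of all admissible pairs with at least the given interaction. Since
`δ` can always be improved by `(δ / 2) ^ 2 / c`, the infimum of `S` is zero. Continuity of the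
interaction concludes without extracting a convergent sequence. -/
theorem interaction_le_interaction_ball_of_bounded [Nontrivial E] (hK : IsRadialKernel K)
    {A B : Set E} (hA : MeasurableSet A) (hB : MeasurableSet B) {R r s : ℝ}
    (hAR : A ⊆ Metric.ball 0 R) (hBR : B ⊆ Metric.ball 0 R)
    (hAr : volume A = volume (Metric.ball (0 : E) r))
    (hBs : volume B = volume (Metric.ball (0 : E) s)) :
    interaction K A B ≤ interaction K (Metric.ball 0 r) (Metric.ball 0 s) := by
  wlog hR : r ≤ R ∧ s ≤ R generalizing R
  · refine this (R := max R (max r s)) (hAR.trans (Metric.ball_subset_ball (by simp)))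
      (hBR.trans (Metric.ball_subset_ball (by simp))) ⟨by simp, by simp⟩
  obtain ⟨hrR, hsR⟩ := hR
  obtain ⟨c, hc0, hct, hc⟩ := exists_polarization_gain (E := E) R
  let S : Set ℝ≥0∞ := {δ | ∃ A' B' : Set E, MeasurableSet A' ∧ MeasurableSet B' ∧
    A' ⊆ Metric.ball 0 R ∧ B' ⊆ Metric.ball 0 R ∧ volume A' = volume (Metric.ball (0 : E) r) ∧
    volume B' = volume (Metric.ball (0 : E) s) ∧ interaction K A B ≤ interaction K A' B' ∧
    δ = volume (A' \ Metric.ball 0 r) + volume (B' \ Metric.ball 0 s)}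
  have hS : volume (A \ Metric.ball 0 r) + volume (B \ Metric.ball 0 s) ∈ S :=
    ⟨A, B, hA, hB, hAR, hBR, hAr, hBs, le_rfl, rfl⟩
  have hfin : ∀ δ ∈ S, δ ≠ ∞ := by
    rintro δ ⟨A', B', -, -, hA', hB', -, -, -, rfl⟩
    exact ENNReal.add_ne_top.2
      ⟨((measure_mono (sdiff_subset.trans hA')).trans_lt measure_ball_lt_top).ne,
        ((measure_mono (sdiff_subset.trans hB')).trans_lt measure_ball_lt_top).ne⟩
  -- The hyperplane is chosen for the set with the larger defect, which is at least `δ / 2`.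
  -- Polarizing the other set along with it does not increase its defect.
  have hstep : ∀ δ ∈ S, ∃ δ' ∈ S, δ' + (δ / 2) ^ 2 / c ≤ δ := by
    rintro δ ⟨A', B', hmA, hmB, hA', hB', hvA, hvB, hI, rfl⟩
    set a := volume (A' \ Metric.ball 0 r)
    set b := volume (B' \ Metric.ball 0 s)
    rcases le_total a b with hab | hab
    · obtain ⟨n, t, hn, ht, h⟩ := hc B' s hmB hB' (Metric.ball_subset_ball hsR) hvB
      refine ⟨_, ⟨polarization n t A', polarization n t B', measurableSet_polarization n t hmA,
        measurableSet_polarization n t hmB, polarization_subset_ball hn ht hA',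
        polarization_subset_ball hn ht hB', (volume_polarization hn t hmA).trans hvA,
        (volume_polarization hn t hmB).trans hvB,
        hI.trans (interaction_le_interaction_polarization hK hn t hmA hmB), rfl⟩, ?_⟩
      have h1 : volume (polarization n t A' \ Metric.ball 0 r) ≤ a :=
        le_self_add.trans (volume_polarization_diff_ball_add_le hn ht hmA r)
      have h2 : (a + b) / 2 ≤ b := by
        refine ENNReal.div_le_of_le_mul ?_
        rw [mul_two]; gcongr
      rw [add_assoc]
      refine add_le_add h1 (le_trans ?_ h)
      gcongr
    · obtain ⟨n, t, hn, ht, h⟩ := hc A' r hmA hA' (Metric.ball_subset_ball hrR) hvA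
      refine ⟨_, ⟨polarization n t A', polarization n t B', measurableSet_polarization n t hmA,
        measurableSet_polarization n t hmB, polarization_subset_ball hn ht hA',
        polarization_subset_ball hn ht hB', (volume_polarization hn t hmA).trans hvA,
        (volume_polarization hn t hmB).trans hvB,
        hI.trans (interaction_le_interaction_polarization hK hn t hmA hmB), rfl⟩, ?_⟩
      have h1 : volume (polarization n t B' \ Metric.ball 0 s) ≤ b :=
        le_self_add.trans (volume_polarization_diff_ball_add_le hn ht hmB s)
      have h2 : (a + b) / 2 ≤ a := by
        refine ENNReal.div_le_of_le_mul ?_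
        rw [mul_two]; gcongr
      rw [add_right_comm]
      refine add_le_add (le_trans ?_ h) h1
      gcongr
  have hinf : sInf S = 0 := by
    by_contra h0
    have hdt : sInf S ≠ ∞ := ne_top_of_le_ne_top (hfin _ hS) (sInf_le hS)
    have hη : (sInf S / 2) ^ 2 / c ≠ 0 := ENNReal.div_ne_zero.2
      ⟨pow_ne_zero _ (ENNReal.div_ne_zero.2 ⟨h0, by norm_num⟩), hct⟩
    have hle : sInf S + (sInf S / 2) ^ 2 / c ≤ sInf S := by
      refine le_sInf fun δ hδ => ?_
      obtain ⟨δ', hδ', h⟩ := hstep δ hδ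
      refine le_trans ?_ h
      gcongr
      · exact sInf_le hδ'
      · exact sInf_le hδ
    exact absurd hle (not_le.2 (ENNReal.lt_add_right hdt hη))
  by_contra! hlt
  set e := interaction K A B - interaction K (Metric.ball 0 r) (Metric.ball 0 s) with he
  have he0 : e ≠ 0 := (tsub_pos_of_lt hlt).ne'
  -- An excess `e` over the balls would, by continuity, keep all defects away from zero.
  have hall : ∀ δ ∈ S, e / ∫⁻ x, K x ≤ δ := by
    rintro δ ⟨A', B', hmA, hmB, hA', hB', hvA, hvB, hI, rfl⟩
    refine ENNReal.div_le_of_le_mul ?_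
    rw [he, tsub_le_iff_left]
    exact hI.trans (interaction_le_add hK hmA hmB measurableSet_ball measurableSet_ball)
  have : e / ∫⁻ x, K x ≤ 0 := hinf ▸ le_sInf hall
  rw [nonpos_iff_eq_zero, ENNReal.div_eq_zero_iff] at this
  exact this.elim he0 hK.lintegral_ne_top

theorem exists_volume_ball_eq [Nontrivial E] {A : Set E} (hA : volume A ≠ ∞) :
    ∃ r : ℝ, 0 ≤ r ∧ volume A = volume (Metric.ball (0 : E) r) := by
  have hB0 : volume (Metric.ball (0 : E) 1) ≠ 0 := (Metric.measure_ball_pos volume _ one_pos).ne'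
  have hBt : volume (Metric.ball (0 : E) 1) ≠ ⊤ := measure_ball_lt_top.ne
  have hd : Module.finrank ℝ E ≠ 0 := Module.finrank_pos.ne'
  refine ⟨(volume A / volume (Metric.ball (0 : E) 1)).toReal ^ (Module.finrank ℝ E : ℝ)⁻¹,
    by positivity, ?_⟩
  rw [Measure.addHaar_ball volume _ (by positivity),
    Real.rpow_inv_natCast_pow ENNReal.toReal_nonneg hd,
    ENNReal.ofReal_toReal (ENNReal.div_ne_top hA hB0), ENNReal.div_mul_cancel hB0 hBt]

/-- The Riesz rearrangement inequality for two sets of finite measure and a radial kernel. -/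
theorem interaction_le_interaction_ball [Nontrivial E] (hK : IsRadialKernel K)
    {A B : Set E} (hA : MeasurableSet A) (hB : MeasurableSet B) {r s : ℝ}
    (hAr : volume A = volume (Metric.ball (0 : E) r))
    (hBs : volume B = volume (Metric.ball (0 : E) s)) :
    interaction K A B ≤ interaction K (Metric.ball 0 r) (Metric.ball 0 s) := by
  have hball : ∀ {A : Set E} {r : ℝ} (j : ℕ), volume A = volume (Metric.ball (0 : E) r) →
      ∃ r', volume (A ∩ Metric.ball 0 (j : ℝ)) = volume (Metric.ball (0 : E) r') ∧
        volume (Metric.ball (0 : E) r' \ Metric.ball 0 r) = 0 := by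
    intro A r j h
    have hf : volume A ≠ ∞ := h ▸ measure_ball_lt_top.ne
    have hle : volume (A ∩ Metric.ball 0 (j : ℝ)) ≤ volume A := measure_mono inter_subset_left
    obtain ⟨r', -, hr'⟩ := exists_volume_ball_eq (ne_top_of_le_ne_top hf hle)
    refine ⟨r', hr', ?_⟩
    -- Since `r` may be negative, `r'` can exceed it. The difference of the balls is null all the
    -- same.
    rcases le_total r' r with hrr | hrr
    · rw [sdiff_eq_empty.2 (Metric.ball_subset_ball hrr), measure_empty]
    · rw [measure_sdiff (Metric.ball_subset_ball hrr) measurableSet_ball.nullMeasurableSet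
        measure_ball_lt_top.ne, ← hr', ← h, tsub_eq_zero_of_le hle]
  have htend : ∀ {A : Set E}, MeasurableSet A → volume A ≠ ∞ →
      Filter.Tendsto (fun j : ℕ => volume (A \ (A ∩ Metric.ball 0 (j : ℝ)))) Filter.atTop (𝓝 0) := by
    intro A hA hf
    have h := tendsto_measure_iInter_atTop (μ := volume)
      (s := fun j : ℕ => A \ (A ∩ Metric.ball 0 (j : ℝ)))
      (fun j => (hA.diff (hA.inter measurableSet_ball)).nullMeasurableSet)
      (fun i j hij => sdiff_subset_sdiff_right
        (inter_subset_inter_right _ (Metric.ball_subset_ball (by exact_mod_cast hij))))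
      ⟨0, ne_top_of_le_ne_top hf (measure_mono sdiff_subset)⟩
    have h0 : ⋂ j : ℕ, A \ (A ∩ Metric.ball 0 (j : ℝ)) = ∅ := by
      refine eq_empty_of_forall_notMem fun x hx => ?_
      obtain ⟨j, hj⟩ := exists_nat_gt ‖x‖
      have hxj := mem_iInter.1 hx j
      exact hxj.2 ⟨hxj.1, mem_ball_zero_iff.2 hj⟩
    rw [h0, measure_empty] at h
    exact h
  -- Truncation to balls of radius `j` costs an error that vanishes as `j → ∞`.
  have hlim : Filter.Tendsto (fun j : ℕ => interaction K (Metric.ball 0 r) (Metric.ball 0 s) +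
      (volume (A \ (A ∩ Metric.ball 0 (j : ℝ))) + volume (B \ (B ∩ Metric.ball 0 (j : ℝ)))) *
        ∫⁻ x, K x) Filter.atTop
      (𝓝 (interaction K (Metric.ball 0 r) (Metric.ball 0 s) + (0 + 0) * ∫⁻ x, K x)) := by
    refine Filter.Tendsto.const_add _ (ENNReal.Tendsto.mul_const ?_ (.inr hK.lintegral_ne_top))
    exact (htend hA (hAr ▸ measure_ball_lt_top.ne)).add (htend hB (hBs ▸ measure_ball_lt_top.ne))
  rw [add_zero, zero_mul, add_zero] at hlim
  refine ge_of_tendsto' hlim fun j => ?_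
  obtain ⟨r', hr', hr0⟩ := hball j hAr
  obtain ⟨s', hs', hs0⟩ := hball j hBs
  have mA : MeasurableSet (A ∩ Metric.ball 0 (j : ℝ)) := hA.inter measurableSet_ball
  have mB : MeasurableSet (B ∩ Metric.ball 0 (j : ℝ)) := hB.inter measurableSet_ball
  refine (interaction_le_add hK hA hB mA mB).trans ?_
  gcongr
  refine (interaction_le_interaction_ball_of_bounded hK mA mB inter_subset_right
    inter_subset_right hr' hs').trans ?_
  refine (interaction_le_add hK measurableSet_ball measurableSet_ball
    (measurableSet_ball (x := 0) (ε := r)) (measurableSet_ball (x := 0) (ε := s))).trans_eq ?_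
  rw [hr0, hs0, add_zero, zero_mul, add_zero]

end Riesz

/-! ### Equality in Riesz's inequality -/

section Rigidity

variable {E : Type*} [NormedAddCommGroup E] [InnerProductSpace ℝ E] [FiniteDimensional ℝ E]
  [MeasurableSpace E] [BorelSpace E] {K : E → ℝ≥0∞}

theorem volume_lossSet_neg {n : E} (hn : ‖n‖ = 1) (t : ℝ) (A : Set E) :
    volume (lossSet (-n) (-t) A) = volume (gainSet n t A) := by
  rw [← volume_preimage_hyperRefl hn t (gainSet n t A)]
  congr 1
  ext x
  simp [lossSet, gainSet, height_neg, hyperRefl_neg, height_hyperRefl hn, hyperRefl_hyperRefl hn,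
    and_comm]

theorem volume_gainSet_neg {n : E} (hn : ‖n‖ = 1) (t : ℝ) (A : Set E) :
    volume (gainSet (-n) (-t) A) = volume (lossSet n t A) := by
  rw [← volume_lossSet_neg (by rwa [norm_neg]), neg_neg, neg_neg]

theorem ae_mem_iff_hyperRefl_mem {n : E} (hn : ‖n‖ = 1) {t : ℝ} {A : Set E}
    (hg : volume (gainSet n t A) = 0) (hl : volume (lossSet n t A) = 0) :
    ∀ᵐ x, x ∈ A ↔ hyperRefl n t x ∈ A := by
  have hg' := (volume_preimage_hyperRefl hn t (gainSet n t A)).trans hg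
  have hl' := (volume_preimage_hyperRefl hn t (lossSet n t A)).trans hl
  refine measure_mono_null ?_ (measure_union_null (measure_union_null hg hl)
    (measure_union_null hg' hl'))
  intro x hx
  have hx : ¬(x ∈ A ↔ hyperRefl n t x ∈ A) := hx
  simp only [mem_union, mem_preimage, gainSet, lossSet, mem_ofPred_eq, height_hyperRefl hn,
    hyperRefl_hyperRefl hn]
  rcases lt_trichotomy (height n t x) 0 with h | h | h
  · have : 0 < -height n t x := by linarith
    tauto
  · simp [hyperRefl, h] at hx
  · tauto

/-- The bounded weight `φ` increases strictly along `v`, while invariance of `A` gives `φ` and its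
translate the same finite integral over `A`. -/
theorem volume_eq_zero_of_ae_mem_iff_add_mem {A : Set E} (hA : MeasurableSet A)
    (hAf : volume A ≠ ∞) {v : E} (hv : v ≠ 0) (h : ∀ᵐ x, x ∈ A ↔ x + v ∈ A) : volume A = 0 := by
  let φ : E → ℝ≥0∞ := fun x => ENNReal.ofReal (Real.arctan (inner ℝ v x) + Real.pi / 2)
  have hφ : Measurable φ := by
    have : Continuous fun x : E => Real.arctan (inner ℝ v x) + Real.pi / 2 :=
      (Real.continuous_arctan.comp (by fun_prop)).add continuous_const
    exact this.measurable.ennreal_ofReal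
  have hlt : ∀ x, φ x < φ (x + v) := by
    intro x
    have h1 : 0 < inner ℝ v v := real_inner_self_pos.2 hv
    have h2 := Real.arctan_strictMono (show inner ℝ v x < inner ℝ v (x + v) by
      rw [inner_add_right]; linarith)
    have h3 := Real.neg_pi_div_two_lt_arctan (inner ℝ v x)
    exact (ENNReal.ofReal_lt_ofReal_iff (by linarith)).2 (by linarith)
  have hbd : ∀ x, φ x ≤ ENNReal.ofReal Real.pi := fun x => ENNReal.ofReal_le_ofReal (by
    linarith [Real.arctan_lt_pi_div_two (inner ℝ v x)])
  have mA := measurable_indicator_one hA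
  have heq : ∫⁻ x, A.indicator 1 x * φ (x + v) = ∫⁻ x, A.indicator 1 x * φ x := by
    rw [← lintegral_add_right_eq_self (fun x => A.indicator 1 x * φ x) v]
    refine lintegral_congr_ae (h.mono fun x hx => ?_)
    by_cases hxA : x ∈ A
    · simp [hxA, hx.1 hxA]
    · have hxv : x + v ∉ A := fun h' => hxA (hx.2 h')
      simp [hxA, hxv]
  have hae := ae_eq_of_ae_le_of_lintegral_le (μ := volume)
    (f := fun x => A.indicator 1 x * φ x) (g := fun x => A.indicator 1 x * φ (x + v))
    (.of_forall fun x => by dsimp only; gcongr; exact (hlt x).le) ?_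
    (mA.mul (hφ.comp (measurable_add_const v))).aemeasurable heq.le
  · refine measure_mono_null (fun x hx => ?_) (ae_iff.1 hae)
    simpa [hx] using (hlt x).ne
  · refine ne_top_of_le_ne_top (ENNReal.mul_ne_top hAf (ENNReal.ofReal_ne_top (r := Real.pi))) ?_
    rw [← lintegral_indicator_one hA, ← lintegral_mul_const _ mA]
    gcongr with x
    exact hbd x

theorem hyperRefl_hyperRefl_of_ne {n : E} (hn : ‖n‖ = 1) (t t' : ℝ) (x : E) :
    hyperRefl n t' (hyperRefl n t x) = x + (t' - t) • n := by
  have h : height n t' (hyperRefl n t x) = -height n t x + t - t' := by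
    rw [← height_hyperRefl hn]; simp only [height]; ring
  rw [hyperRefl, h, hyperRefl]
  simp only [sub_smul, add_smul, neg_smul]
  abel

/-- Reflections in two distinct parallel hyperplanes compose to a nonzero translation. -/
theorem volume_eq_zero_of_two_symmetries {n : E} (hn : ‖n‖ = 1) {t t' : ℝ} (htt : t ≠ t')
    {A : Set E} (hA : MeasurableSet A) (hAf : volume A ≠ ∞)
    (h : ∀ᵐ x, x ∈ A ↔ hyperRefl n t x ∈ A) (h' : ∀ᵐ x, x ∈ A ↔ hyperRefl n t' x ∈ A) :
    volume A = 0 := by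
  have hn0 : n ≠ 0 := fun h0 => by simp [h0] at hn
  refine volume_eq_zero_of_ae_mem_iff_add_mem hA hAf (v := (t' - t) • n)
    (smul_ne_zero (sub_ne_zero.2 htt.symm) hn0) ?_
  filter_upwards [h, (measurePreserving_hyperRefl hn t).quasiMeasurePreserving.ae h'] with x h1 h2
  rw [h1, h2, hyperRefl_hyperRefl_of_ne hn]

/-- Take a compact `k` of positive measure in the gain set. Its heights are bounded away from zero,
so it stays on the positive side for nearby `t'`. The mirror image `Q` of `k` moves by `(t' - t) •
n`, and a slightly translated compact set of positive measure still overlaps itself in positive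
measure. -/
theorem eventually_volume_gainSet_ne_zero {n : E} (hn : ‖n‖ = 1) {t : ℝ} {A : Set E}
    (hA : MeasurableSet A) (h : volume (gainSet n t A) ≠ 0) :
    ∀ᶠ t' in 𝓝 t, volume (gainSet n t' A) ≠ 0 := by
  obtain ⟨k, hkU, hk, hk0⟩ := (measurableSet_gainSet n t hA).exists_lt_isCompact
    (pos_iff_ne_zero.2 h)
  have hne : k.Nonempty := nonempty_of_measure_ne_zero hk0.ne'
  obtain ⟨x₀, hx₀, hmin⟩ := hk.exists_isMinOn hne (continuous_height n t).continuousOn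
  have hδ : 0 < height n t x₀ := (hkU hx₀).1
  set Q := hyperRefl n t '' k with hQdef
  have hQ : IsCompact Q := hk.image (continuous_hyperRefl n t)
  have hQpre : hyperRefl n t ⁻¹' Q = k :=
    preimage_image_eq _ (fun x y hxy => by
      rw [← hyperRefl_hyperRefl hn t x, hxy, hyperRefl_hyperRefl hn])
  have hQ0 : volume Q ≠ 0 := by
    rw [← volume_preimage_hyperRefl hn t Q, hQpre]; exact hk0.ne'
  have hev := eventually_nhds_zero_measure_vadd_sdiff_lt (μ := volume) hQ hQ.isClosed hQ0
  have htend : Filter.Tendsto (fun t' : ℝ => (t' - t) • n) (𝓝 t) (𝓝 0) := by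
    have : Continuous fun t' : ℝ => (t' - t) • n := by fun_prop
    simpa using this.tendsto t
  have hclose : ∀ᶠ t' in 𝓝 t, t' < t + height n t x₀ := eventually_lt_nhds (by linarith)
  filter_upwards [htend.eventually hev, hclose] with t' ht' hlt
  have hpos : volume (((t' - t) • n +ᵥ Q) ∩ Q) ≠ 0 := by
    intro h0
    have h1 := measure_le_inter_add_sdiff volume ((t' - t) • n +ᵥ Q) Q
    rw [h0, zero_add, measure_vadd] at h1
    exact absurd ht' (not_lt.2 h1)
  rw [← volume_preimage_hyperRefl hn t'] at hpos
  refine fun h0 => hpos (measure_mono_null ?_ h0)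
  rintro x ⟨hx1, hx2⟩
  obtain ⟨z, hz, hzx⟩ := hx1
  have hstep : ∀ y, hyperRefl n t' y = (t' - t) • n + hyperRefl n t y := fun y => by
    simp only [hyperRefl, height, sub_smul]; abel
  have hxk : x ∈ k := by
    rw [← hQpre]
    have : z = hyperRefl n t x := by
      rw [hstep x] at hzx
      simpa using hzx
    rw [mem_preimage, ← this]
    exact hz
  refine ⟨?_, (hkU hxk).2.1, ?_⟩
  · have h1 : height n t x₀ ≤ height n t x := hmin hxk
    have h2 : height n t' x = height n t x - (t' - t) := by simp only [height]; ring
    linarith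
  · obtain ⟨w, hw, hwx⟩ := hx2
    rw [← hwx]
    exact (hkU hw).2.2

theorem eventually_volume_lossSet_ne_zero {n : E} (hn : ‖n‖ = 1) {t : ℝ} {A : Set E}
    (hA : MeasurableSet A) (h : volume (lossSet n t A) ≠ 0) :
    ∀ᶠ t' in 𝓝 t, volume (lossSet n t' A) ≠ 0 := by
  rw [← volume_gainSet_neg hn] at h
  have h1 := eventually_volume_gainSet_ne_zero (by rwa [norm_neg]) hA h
  have h2 : Filter.Tendsto (fun t' : ℝ => -t') (𝓝 t) (𝓝 (-t)) := continuous_neg.tendsto t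
  filter_upwards [h2.eventually h1] with t' ht'
  rwa [volume_gainSet_neg hn] at ht'

/-- If two sets are never ordered in opposite ways by a reflection, then each of them is
ordered one way by every reflection. -/
theorem volume_gainSet_eq_zero_or_volume_lossSet_eq_zero {A B : Set E} (hA : MeasurableSet A)
    (hB : MeasurableSet B) (hBf : volume B ≠ ∞) (hB0 : volume B ≠ 0)
    (hAB : ∀ (n : E) (t : ℝ), ‖n‖ = 1 → volume (gainSet n t A) = 0 ∨ volume (lossSet n t B) = 0)
    (hBA : ∀ (n : E) (t : ℝ), ‖n‖ = 1 → volume (gainSet n t B) = 0 ∨ volume (lossSet n t A) = 0)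
    {n : E} (hn : ‖n‖ = 1) (t : ℝ) :
    volume (gainSet n t A) = 0 ∨ volume (lossSet n t A) = 0 := by
  by_contra! hcon
  have hev := (eventually_volume_gainSet_ne_zero hn hA hcon.1).and
    (eventually_volume_lossSet_ne_zero hn hA hcon.2)
  -- Near `t` the set `A` has both gains and losses, so `B` has neither and is symmetric about many
  -- parallel hyperplanes.
  have hsymm : ∀ᶠ t' in 𝓝 t, ∀ᵐ x, x ∈ B ↔ hyperRefl n t' x ∈ B := hev.mono fun t' ht' =>
    ae_mem_iff_hyperRefl_mem hn ((hBA n t' hn).resolve_right ht'.2)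
      ((hAB n t' hn).resolve_left ht'.1)
  obtain ⟨t', h', hne⟩ := ((hsymm.filter_mono nhdsWithin_le_nhds).and
    (self_mem_nhdsWithin (a := t) (s := {t}ᶜ))).exists
  exact hB0 (volume_eq_zero_of_two_symmetries hn (Ne.symm hne) hB hBf hsymm.self_of_nhds h')

/-- Once the hyperplane is so far out that less than half of `A` lies behind it, the part in front
cannot be mirrored into `A`. -/
theorem exists_volume_gainSet_ne_zero {A : Set E} (hA : MeasurableSet A) (hAf : volume A ≠ ∞)
    (hA0 : volume A ≠ 0) {n : E} (hn : ‖n‖ = 1) : ∃ t, volume (gainSet n t A) ≠ 0 := by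
  by_contra! hcon
  have hm : ∀ t : ℝ, MeasurableSet {x : E | height n t x ≤ 0} := fun t =>
    measurableSet_le (continuous_height n t).measurable measurable_const
  have htend := tendsto_measure_iInter_atTop (μ := volume)
    (s := fun j : ℕ => A ∩ {x | height n (-(j : ℝ)) x ≤ 0})
    (fun j => (hA.inter (hm _)).nullMeasurableSet)
    (fun i j hij => inter_subset_inter_right _ fun x hx => by
      have : (i : ℝ) ≤ j := by exact_mod_cast hij
      simp only [height, mem_ofPred_eq] at hx ⊢
      linarith)
    ⟨0, ne_top_of_le_ne_top hAf (measure_mono inter_subset_left)⟩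
  have h0 : ⋂ j : ℕ, A ∩ {x | height n (-(j : ℝ)) x ≤ 0} = ∅ := by
    refine eq_empty_of_forall_notMem fun x hx => ?_
    obtain ⟨j, hj⟩ := exists_nat_gt (-(2 * inner ℝ n x))
    have hxj : height n (-(j : ℝ)) x ≤ 0 := (mem_iInter.1 hx j).2
    simp only [height] at hxj
    linarith
  rw [h0, measure_empty] at htend
  obtain ⟨j, hj⟩ := (htend.eventually_lt_const (ENNReal.half_pos hA0)).exists
  have hj : volume (A ∩ {x | height n (-(j : ℝ)) x ≤ 0}) < volume A / 2 := hj
  have h1 : volume (A \ {x | height n (-(j : ℝ)) x ≤ 0}) ≤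
      volume (A ∩ {x | height n (-(j : ℝ)) x ≤ 0}) := by
    rw [← volume_preimage_hyperRefl hn (-(j : ℝ)) (A ∩ _), ← add_zero (volume (_ ⁻¹' _)),
      ← hcon (-(j : ℝ))]
    refine (measure_mono fun x hx => ?_).trans (measure_union_le _ _)
    have hx2 : 0 < height n (-(j : ℝ)) x := not_le.1 hx.2
    by_cases hxA : hyperRefl n (-(j : ℝ)) x ∈ A
    · exact .inl ⟨hxA, by simp only [mem_ofPred_eq, height_hyperRefl hn]; linarith⟩
    · exact .inr ⟨hx2, hx.1, hxA⟩
  have h2 := measure_le_inter_add_sdiff volume A {x | height n (-(j : ℝ)) x ≤ 0}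
  have h3 := h2.trans (add_le_add_right h1 _)
  refine absurd h3 (not_le.2 ?_)
  calc _ < volume A / 2 + volume A / 2 := ENNReal.add_lt_add hj hj
    _ = volume A := ENNReal.add_halves _

/-- The parameters with a gain and those with a loss form two nonempty open sets, disjoint by `h`.
They cannot cover the connected line, and any remaining `t` gives a symmetry. -/
theorem exists_symmetry {A : Set E} (hA : MeasurableSet A) (hAf : volume A ≠ ∞)
    (hA0 : volume A ≠ 0)
    (h : ∀ (n : E) (t : ℝ), ‖n‖ = 1 → volume (gainSet n t A) = 0 ∨ volume (lossSet n t A) = 0)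
    {n : E} (hn : ‖n‖ = 1) : ∃ t, ∀ᵐ x, x ∈ A ↔ hyperRefl n t x ∈ A := by
  have hG : IsOpen {t | volume (gainSet n t A) ≠ 0} :=
    isOpen_iff_eventually.2 fun t ht => eventually_volume_gainSet_ne_zero hn hA ht
  have hL : IsOpen {t | volume (lossSet n t A) ≠ 0} :=
    isOpen_iff_eventually.2 fun t ht => eventually_volume_lossSet_ne_zero hn hA ht
  by_contra hcon
  have hU : ∀ t, volume (gainSet n t A) ≠ 0 ∨ volume (lossSet n t A) ≠ 0 := by
    intro t
    by_contra! h0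
    exact hcon ⟨t, ae_mem_iff_hyperRefl_mem hn h0.1 h0.2⟩
  obtain ⟨t₁, h₁⟩ := exists_volume_gainSet_ne_zero hA hAf hA0 hn
  obtain ⟨t₂, h₂⟩ := exists_volume_gainSet_ne_zero hA hAf hA0 (n := -n) (by rwa [norm_neg])
  rw [← neg_neg t₂, volume_gainSet_neg hn] at h₂
  obtain ⟨t, -, ht, ht'⟩ := isPreconnected_univ _ _ hG hL (fun t _ => hU t) ⟨t₁, trivial, h₁⟩
    ⟨-t₂, trivial, h₂⟩
  exact (h n t hn).elim ht ht'

/-- The symmetries in the directions of an orthonormal basis compose to the reflection in the point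
common to their hyperplanes. -/
theorem exists_central_symmetry {A : Set E}
    (h : ∀ n : E, ‖n‖ = 1 → ∃ t, ∀ᵐ x, x ∈ A ↔ hyperRefl n t x ∈ A) :
    ∃ c : E, ∀ᵐ x, x ∈ A ↔ (2 : ℝ) • c - x ∈ A := by
  let b := stdOrthonormalBasis ℝ E
  have hb : ∀ i, ‖b i‖ = 1 := b.orthonormal.1
  choose t ht using fun i => h (b i) (hb i)
  -- Orthogonality leaves the height in a new direction unaffected by the earlier reflections.
  -- Measure preservation is carried along to pull back the next almost everywhere statement.
  have key : ∀ s : Finset (Fin (Module.finrank ℝ E)),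
      MeasurePreserving (fun x => x - ∑ i ∈ s, height (b i) (t i) x • b i) volume volume ∧
        ∀ᵐ x, x ∈ A ↔ x - ∑ i ∈ s, height (b i) (t i) x • b i ∈ A := by
    intro s
    induction s using Finset.induction_on with
    | empty =>
      simp only [Finset.sum_empty, sub_zero, iff_self, Filter.eventually_true, and_true]
      exact MeasurePreserving.id volume
    | insert j s hj ih =>
      obtain ⟨h1, h2⟩ := ih
      have hcomp : (fun x => x - ∑ i ∈ insert j s, height (b i) (t i) x • b i) =
          hyperRefl (b j) (t j) ∘ fun x => x - ∑ i ∈ s, height (b i) (t i) x • b i := by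
        funext x
        have : height (b j) (t j) (x - ∑ i ∈ s, height (b i) (t i) x • b i) =
            height (b j) (t j) x := by
          have h0 : inner ℝ (b j) (∑ i ∈ s, height (b i) (t i) x • b i) = 0 := by
            rw [inner_sum]
            refine Finset.sum_eq_zero fun i hi => ?_
            rw [inner_smul_right, b.orthonormal.2 (fun hji : j = i => hj (by rwa [hji])), mul_zero]
          simp only [height] at h0 ⊢
          rw [inner_sub_right, h0, sub_zero]
        simp only [Function.comp_apply, hyperRefl, this, Finset.sum_insert hj]
        abel
      refine ⟨hcomp ▸ (measurePreserving_hyperRefl (hb j) (t j)).comp h1, ?_⟩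
      filter_upwards [h2, h1.quasiMeasurePreserving.ae (ht j)] with x hx1 hx2
      rw [hx1, hx2]
      exact iff_of_eq (congrArg (· ∈ A) (congrFun hcomp x).symm)
  refine ⟨∑ i, (t i / 2) • b i, (key Finset.univ).2.mono fun x hx => ?_⟩
  rw [hx]
  have h1 : ∑ i, height (b i) (t i) x • b i = (2 : ℝ) • x - (2 : ℝ) • ∑ i, (t i / 2) • b i := by
    conv_rhs => rw [← b.sum_repr' x]
    rw [← smul_sub, ← Finset.sum_sub_distrib, Finset.smul_sum]
    refine Finset.sum_congr rfl fun i _ => ?_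
    rw [← sub_smul, smul_smul, height]
    congr 1; ring
  rw [h1, two_smul ℝ x]
  exact iff_of_eq (congrArg (· ∈ A) (by abel))

/-- Reflection in `c` sends the negative side into the positive one, so at least as much of `A` lies
in front as behind. A loss of positive measure without a gain would put strictly more of `A` behind.
-/
theorem volume_lossSet_eq_zero_of_central_symmetry {A : Set E} (hA : MeasurableSet A)
    (hAf : volume A ≠ ∞)
    (h : ∀ (n : E) (t : ℝ), ‖n‖ = 1 → volume (gainSet n t A) = 0 ∨ volume (lossSet n t A) = 0)
    {c : E} (hc : ∀ᵐ x, x ∈ A ↔ (2 : ℝ) • c - x ∈ A) {n : E} (hn : ‖n‖ = 1) {t : ℝ}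
    (ht : 0 < height n t c) : volume (lossSet n t A) = 0 := by
  refine (h n t hn).elim (fun hg => ?_) id
  set S := {x | 0 < height n t x ∧ x ∈ A ∧ hyperRefl n t x ∈ A} with hS
  have mS : MeasurableSet S := (measurableSet_lt measurable_const
    (continuous_height n t).measurable).inter
      (hA.inter ((continuous_hyperRefl n t).measurable hA))
  have hSf : volume S ≠ ∞ := ne_top_of_le_ne_top hAf (measure_mono fun x hx => hx.2.1)
  have h1 : volume {x | 0 < height n t x ∧ x ∈ A} ≤ volume S := by
    rw [← add_zero (volume S), ← hg]
    refine (measure_mono fun x hx => ?_).trans (measure_union_le _ _)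
    by_cases hxA : hyperRefl n t x ∈ A
    · exact .inl ⟨hx.1, hx.2, hxA⟩
    · exact .inr ⟨hx.1, hx.2, hxA⟩
  have h2 : volume (lossSet n t A) + volume S ≤ volume {x | height n t x < 0 ∧ x ∈ A} := by
    have hd : Disjoint (lossSet n t A) S :=
      disjoint_left.2 fun x hx hx' => hx.2.1 hx'.2.1
    rw [← measure_union hd mS, ← volume_preimage_hyperRefl hn t {x | height n t x < 0 ∧ x ∈ A}]
    refine measure_mono ?_
    rintro x (hx | hx)
    · exact ⟨by rw [height_hyperRefl hn]; linarith [hx.1], hx.2.2⟩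
    · exact ⟨by rw [height_hyperRefl hn]; linarith [hx.1], hx.2.2⟩
  have h3 : volume {x | height n t x < 0 ∧ x ∈ A} ≤ volume {x | 0 < height n t x ∧ x ∈ A} := by
    have hmp : MeasurePreserving (fun x : E => (2 : ℝ) • c - x) volume volume :=
      Measure.measurePreserving_sub_left volume _
    have mT : MeasurableSet {x | 0 < height n t x ∧ x ∈ A} :=
      (measurableSet_lt measurable_const (continuous_height n t).measurable).inter hA
    rw [← hmp.measure_preimage mT.nullMeasurableSet]
    refine measure_mono_ae (hc.mono fun x hx hxA => ?_)
    refine ⟨?_, hx.1 hxA.2⟩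
    have h4 := hxA.1
    simp only [height, inner_sub_right, inner_smul_right] at ht h4 ⊢
    linarith
  have h4 : volume (lossSet n t A) + volume S ≤ 0 + volume S := by
    rw [zero_add]; exact h2.trans (h3.trans h1)
  exact nonpos_iff_eq_zero.1 ((ENNReal.add_le_add_iff_right hSf).1 h4)

/-- If `A` is not the ball `B` of its volume around `c`, some reflection carries a part of `A \ B`
of positive measure into `B \ A`, hence closer to `c`. This is a loss on the side of `c`. -/
theorem ae_eq_ball_of_volume_lossSet_eq_zero [Nontrivial E] {A : Set E} (hA : MeasurableSet A)
    (hAf : volume A ≠ ∞) {c : E}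
    (h : ∀ (n : E) (t : ℝ), ‖n‖ = 1 → 0 < height n t c → volume (lossSet n t A) = 0) :
    ∃ r, A =ᵐ[volume] Metric.ball c r := by
  obtain ⟨r, -, hr⟩ := exists_volume_ball_eq hAf
  rw [← Measure.addHaar_ball_center volume c r] at hr
  refine ⟨r, ?_⟩
  have hsymm := volume_diff_eq_volume_diff hA measurableSet_ball hr hAf
  suffices h0 : volume (A \ Metric.ball c r) = 0 from
    ae_eq_set.2 ⟨h0, hsymm ▸ h0⟩
  have hmove : ∀ (n : E) (t : ℝ), ‖n‖ = 1 →
      volume {x | x ∈ A \ Metric.ball c r ∧ hyperRefl n t x ∈ Metric.ball c r \ A} = 0 := by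
    intro n t hn
    have hneg : ∀ x, x ∈ A \ Metric.ball c r ∧ hyperRefl n t x ∈ Metric.ball c r \ A →
        height n t c * height n t x < 0 := by
      rintro x ⟨hx, hx'⟩
      have h1 : r ≤ ‖c - x‖ := by
        have := hx.2
        rwa [Metric.mem_ball, dist_comm, dist_eq_norm, not_lt] at this
      have h2 : ‖c - hyperRefl n t x‖ < r := by
        have := hx'.1
        rwa [Metric.mem_ball, dist_comm, dist_eq_norm] at this
      have h3 := pow_lt_pow_left₀ (h2.trans_le h1) (norm_nonneg _) two_ne_zero
      rw [norm_sub_hyperRefl_sq hn] at h3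
      linarith
    rcases lt_trichotomy (height n t c) 0 with hc | hc | hc
    · have h1 := h (-n) (-t) (by rwa [norm_neg]) (by rw [height_neg]; linarith)
      rw [volume_lossSet_neg hn] at h1
      refine measure_mono_null (fun x hx => ?_) h1
      exact ⟨pos_of_mul_neg_right (hneg x hx) hc.le, hx.1.1, hx.2.2⟩
    · refine measure_mono_null (t := ∅) (fun x hx => ?_) measure_empty
      have := hneg x hx
      simp [hc] at this
    · have h1 := h n t hn hc
      rw [← volume_preimage_hyperRefl hn t] at h1
      refine measure_mono_null (fun x hx => ?_) h1
      refine ⟨?_, hx.2.2, by rw [hyperRefl_hyperRefl hn]; exact hx.1.1⟩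
      rw [height_hyperRefl hn]
      have := (pos_iff_neg_of_mul_neg (hneg x hx)).1 hc
      linarith
  by_contra h0
  -- The averaging argument needs bounded sets, so both differences are truncated to a large ball.
  have hpos : ∀ {S : Set E}, volume S ≠ 0 →
      ∀ᶠ j : ℕ in Filter.atTop, volume (S ∩ Metric.ball 0 (j : ℝ)) ≠ 0 := by
    intro S hS
    have hmono : Monotone fun j : ℕ => S ∩ Metric.ball (0 : E) (j : ℝ) := fun i j hij =>
      inter_subset_inter_right _ (Metric.ball_subset_ball (by exact_mod_cast hij))
    have := tendsto_measure_iUnion_atTop (μ := volume) hmono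
    rw [← inter_iUnion, Metric.iUnion_ball_nat, inter_univ] at this
    exact this.eventually_ne hS
  obtain ⟨j, hj1, hj2⟩ := ((hpos h0).and (hpos (hsymm ▸ h0))).exists
  obtain ⟨C, -, hC, hCP⟩ := exists_hyperRefl_volume_ge (E := E) (j : ℝ)
  obtain ⟨n, t, hn, hle⟩ := hCP _ _ ((hA.diff measurableSet_ball).inter measurableSet_ball)
    ((measurableSet_ball.diff hA).inter measurableSet_ball) inter_subset_right inter_subset_right
  have hz : volume {x | x ∈ (A \ Metric.ball c r) ∩ Metric.ball 0 (j : ℝ) ∧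
      hyperRefl n t x ∈ (Metric.ball c r \ A) ∩ Metric.ball 0 (j : ℝ)} = 0 :=
    by
    refine measure_mono_null ?_ (hmove n t hn)
    rintro x ⟨hx, hx'⟩
    exact ⟨hx.1, hx'.1⟩
  rw [hz, mul_zero, nonpos_iff_eq_zero, mul_eq_zero] at hle
  exact hle.elim hj1 hj2

theorem ae_mem_iff_hyperRefl_mem_of_ae_eq_ball {A : Set E} {c : E} {r : ℝ}
    (h : A =ᵐ[volume] Metric.ball c r) {n : E} (hn : ‖n‖ = 1) {t : ℝ} (ht : height n t c = 0) :
    ∀ᵐ x, x ∈ A ↔ hyperRefl n t x ∈ A := by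
  have h' := h.mem_iff
  filter_upwards [h', (measurePreserving_hyperRefl hn t).quasiMeasurePreserving.ae h'] with x h1 h2
  have h3 : ‖c - hyperRefl n t x‖ = ‖c - x‖ :=
    (pow_left_inj₀ (norm_nonneg _) (norm_nonneg _) two_ne_zero).1
      (by rw [norm_sub_hyperRefl_sq hn, ht, zero_mul, add_zero])
  rw [h1, h2, Metric.mem_ball, Metric.mem_ball, dist_comm, dist_comm _ c, dist_eq_norm,
    dist_eq_norm, h3]

theorem exists_unit_vector_separating {c c' : E} (h : c ≠ c') :
    ∃ n : E, ‖n‖ = 1 ∧ inner ℝ n c < inner ℝ n c' := by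
  have h0 : 0 < ‖c' - c‖ := norm_pos_iff.2 (sub_ne_zero.2 h.symm)
  refine ⟨‖c' - c‖⁻¹ • (c' - c), by rw [norm_smul, norm_inv, norm_norm, inv_mul_cancel₀ h0.ne'],
    ?_⟩
  rw [← sub_pos, ← inner_sub_right, inner_smul_left, real_inner_self_eq_norm_sq]
  simp only [map_inv₀, conj_trivial]
  positivity

/-- Distinct centers would give symmetries about two parallel hyperplanes orthogonal to the line
joining them. -/
theorem center_unique {A : Set E} (hA : MeasurableSet A) (hAf : volume A ≠ ∞) (hA0 : volume A ≠ 0)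
    {c c' : E} {r r' : ℝ} (h : A =ᵐ[volume] Metric.ball c r)
    (h' : A =ᵐ[volume] Metric.ball c' r') : c = c' := by
  by_contra hne
  obtain ⟨n, hn, hlt⟩ := exists_unit_vector_separating hne
  refine hA0 (volume_eq_zero_of_two_symmetries hn (t := 2 * inner ℝ n c) (t' := 2 * inner ℝ n c')
    (by linarith) hA hAf ?_ ?_)
  · exact ae_mem_iff_hyperRefl_mem_of_ae_eq_ball h hn (by simp [height])
  · exact ae_mem_iff_hyperRefl_mem_of_ae_eq_ball h' hn (by simp [height])

/-- The strict Riesz rearrangement inequality: equality forces concentric balls. -/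
theorem exists_ae_eq_ball_of_interaction_eq [Nontrivial E] (hK : IsRadialKernel K)
    (hKs : ∀ x y, ‖x‖ < ‖y‖ → K y < K x) {A B : Set E} (hA : MeasurableSet A)
    (hB : MeasurableSet B) (hA0 : volume A ≠ 0) (hB0 : volume B ≠ 0) {r s : ℝ}
    (hAr : volume A = volume (Metric.ball (0 : E) r))
    (hBs : volume B = volume (Metric.ball (0 : E) s))
    (h : interaction K (Metric.ball 0 r) (Metric.ball 0 s) ≤ interaction K A B) :
    ∃ (c : E) (r s : ℝ), A =ᵐ[volume] Metric.ball c r ∧ B =ᵐ[volume] Metric.ball c s := by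
  have hAf : volume A ≠ ∞ := hAr ▸ measure_ball_lt_top.ne
  have hBf : volume B ≠ ∞ := hBs ▸ measure_ball_lt_top.ne
  -- The polarized pair is again bounded by the pair of balls, so no polarization raises the
  -- interaction.
  have hpol : ∀ (n : E) (t : ℝ), ‖n‖ = 1 →
      interaction K (polarization n t A) (polarization n t B) ≤ interaction K A B :=
    fun n t hn => (interaction_le_interaction_ball hK (measurableSet_polarization n t hA)
      (measurableSet_polarization n t hB) ((volume_polarization hn t hA).trans hAr)
      ((volume_polarization hn t hB).trans hBs)).trans h
  have hAB : ∀ (n : E) (t : ℝ), ‖n‖ = 1 →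
      volume (gainSet n t A) = 0 ∨ volume (lossSet n t B) = 0 := fun n t hn =>
    volume_gainSet_eq_zero_or hK hKs hn t hA hB hAf (hpol n t hn)
  have hBA : ∀ (n : E) (t : ℝ), ‖n‖ = 1 →
      volume (gainSet n t B) = 0 ∨ volume (lossSet n t A) = 0 := fun n t hn =>
    volume_gainSet_eq_zero_or hK hKs hn t hB hA hBf (by
      rw [interaction_comm hK hB hA, interaction_comm hK (measurableSet_polarization n t hB)
        (measurableSet_polarization n t hA)]
      exact hpol n t hn)
  have h1A : ∀ (n : E) (t : ℝ), ‖n‖ = 1 →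
      volume (gainSet n t A) = 0 ∨ volume (lossSet n t A) = 0 := fun n t hn =>
    volume_gainSet_eq_zero_or_volume_lossSet_eq_zero hA hB hBf hB0 hAB hBA hn t
  have h1B : ∀ (n : E) (t : ℝ), ‖n‖ = 1 →
      volume (gainSet n t B) = 0 ∨ volume (lossSet n t B) = 0 := fun n t hn =>
    volume_gainSet_eq_zero_or_volume_lossSet_eq_zero hB hA hAf hA0 hBA hAB hn t
  obtain ⟨c, hc⟩ := exists_central_symmetry fun n hn => exists_symmetry hA hAf hA0 h1A hn
  obtain ⟨c', hc'⟩ := exists_central_symmetry fun n hn => exists_symmetry hB hBf hB0 h1B hn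
  have hlA : ∀ (n : E) (t : ℝ), ‖n‖ = 1 → 0 < height n t c → volume (lossSet n t A) = 0 :=
    fun n t hn ht => volume_lossSet_eq_zero_of_central_symmetry hA hAf h1A hc hn ht
  have hlB : ∀ (n : E) (t : ℝ), ‖n‖ = 1 → 0 < height n t c' → volume (lossSet n t B) = 0 :=
    fun n t hn ht => volume_lossSet_eq_zero_of_central_symmetry hB hBf h1B hc' hn ht
  obtain ⟨r₁, hr₁⟩ := ae_eq_ball_of_volume_lossSet_eq_zero hA hAf hlA
  obtain ⟨s₁, hs₁⟩ := ae_eq_ball_of_volume_lossSet_eq_zero hB hBf hlB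
  suffices hcc : c = c' from ⟨c, r₁, s₁, hr₁, hcc ▸ hs₁⟩
  by_contra hne
  obtain ⟨n, hn, hlt⟩ := exists_unit_vector_separating hne
  -- The hyperplane orthogonal to `n` through the midpoint of `c` and `c'`. It orders `A` and `B` in
  -- opposite directions, so one of them must be symmetric about it although its center lies off it.
  set t := inner ℝ n c + inner ℝ n c' with ht
  have h2 : height n t c < 0 := by simp only [height, ht]; linarith
  have h3 : 0 < height n t c' := by simp only [height, ht]; linarith
  have h4 := hlB n t hn h3
  have h5 := hlA (-n) (-t) (by rwa [norm_neg]) (by rw [height_neg]; linarith)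
  rw [volume_lossSet_neg hn] at h5
  rcases hBA n t hn with h6 | h6
  · refine hB0 (volume_eq_zero_of_two_symmetries hn (t := t) (t' := 2 * inner ℝ n c')
      (by linarith) hB hBf (ae_mem_iff_hyperRefl_mem hn h6 h4) ?_)
    exact ae_mem_iff_hyperRefl_mem_of_ae_eq_ball hs₁ hn (by simp [height])
  · refine hA0 (volume_eq_zero_of_two_symmetries hn (t := t) (t' := 2 * inner ℝ n c)
      (by linarith) hA hAf (ae_mem_iff_hyperRefl_mem hn h5 h6) ?_)
    exact ae_mem_iff_hyperRefl_mem_of_ae_eq_ball hr₁ hn (by simp [height])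

end Rigidity

/-! ### Level sets of the symmetric decreasing rearrangement -/

section Rearrangement

variable {m : ℕ}

theorem nontrivial_euclideanSpace (hm : 1 ≤ m) : Nontrivial (EuclideanSpace ℝ (Fin m)) := by
  have : Nonempty (Fin m) := ⟨⟨0, hm⟩⟩
  infer_instance

theorem schwarzSymm_congr {A B : Set (EuclideanSpace ℝ (Fin m))} (h : volume A = volume B) :
    schwarzSymm A = schwarzSymm B := by
  unfold schwarzSymm; rw [h]

theorem exists_schwarzSymm_eq_ball (hm : 1 ≤ m) {A : Set (EuclideanSpace ℝ (Fin m))}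
    (hA : volume A ≠ ∞) : ∃ r, 0 ≤ r ∧ schwarzSymm A = Metric.ball 0 r ∧
      volume A = volume (Metric.ball (0 : EuclideanSpace ℝ (Fin m)) r) := by
  have h : schwarzSymm A = Metric.ball 0
      ((volume A / volume (Metric.ball (0 : EuclideanSpace ℝ (Fin m)) 1)).toReal ^
        (m : ℝ)⁻¹) := if_neg hA
  exact ⟨_, by positivity, h, by rw [← h, volume_schwarzSymm hm]⟩

/-- This form covers finite and infinite measure at once and is visibly monotone in the measure of
`A`. -/
theorem mem_schwarzSymm_iff (hm : 1 ≤ m) {A : Set (EuclideanSpace ℝ (Fin m))}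
    {x : EuclideanSpace ℝ (Fin m)} :
    x ∈ schwarzSymm A ↔
      volume (Metric.ball (0 : EuclideanSpace ℝ (Fin m)) ‖x‖) < volume A := by
  have := nontrivial_euclideanSpace hm
  by_cases hA : volume A = ∞
  · have h : schwarzSymm A = univ := if_pos hA
    rw [h, hA]
    exact iff_of_true trivial measure_ball_lt_top
  · obtain ⟨r, hr, hAr, hv⟩ := exists_schwarzSymm_eq_ball hm hA
    rw [hAr, hv, mem_ball_zero_iff]
    constructor
    · intro h
      rw [Measure.addHaar_ball _ _ (norm_nonneg x), Measure.addHaar_ball _ _ hr]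
      refine ENNReal.mul_lt_mul_left (Metric.measure_ball_pos volume _ one_pos).ne'
        measure_ball_lt_top.ne ?_
      have hd : Module.finrank ℝ (EuclideanSpace ℝ (Fin m)) ≠ 0 := Module.finrank_pos.ne'
      have hlt := pow_lt_pow_left₀ h (norm_nonneg x) hd
      exact (ENNReal.ofReal_lt_ofReal_iff ((by positivity : (0 : ℝ) ≤ _).trans_lt hlt)).2 hlt
    · intro h
      by_contra! hle
      exact absurd (measure_mono (Metric.ball_subset_ball hle)) (not_le.2 h)

theorem measurableSet_schwarzSymm (A : Set (EuclideanSpace ℝ (Fin m))) :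
    MeasurableSet (schwarzSymm A) := by
  unfold schwarzSymm
  split_ifs
  · exact MeasurableSet.univ
  · exact measurableSet_ball

variable {f : EuclideanSpace ℝ (Fin m) → ℝ}

theorem symmDecrRearr_nonneg (f : EuclideanSpace ℝ (Fin m) → ℝ) (x : EuclideanSpace ℝ (Fin m)) :
    0 ≤ symmDecrRearr f x :=
  Real.sSup_nonneg fun _ hτ => hτ.1.le

/-- For `x ≠ 0` the supremum is over a bounded set, since high level sets become smaller than the
ball of radius `‖x‖`. The converse uses continuity of the measure from below, as the levels `σ + 1 /
(j + 1)` decrease to `σ`. -/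
theorem lt_symmDecrRearr_iff (hm : 1 ≤ m) (hf : Measurable f)
    (hfin : ∀ τ : ℝ, 0 < τ → volume {x | τ < |f x|} < ⊤) {σ : ℝ} (hσ : 0 < σ)
    {x : EuclideanSpace ℝ (Fin m)} (hx : x ≠ 0) :
    σ < symmDecrRearr f x ↔ x ∈ schwarzSymm {y | σ < |f y|} := by
  have := nontrivial_euclideanSpace hm
  have hmono : ∀ {σ τ : ℝ}, σ ≤ τ → volume {y | τ < |f y|} ≤ volume {y | σ < |f y|} :=
    fun h => measure_mono fun y hy => lt_of_le_of_lt h hy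
  have hpos : 0 < volume (Metric.ball (0 : EuclideanSpace ℝ (Fin m)) ‖x‖) :=
    Metric.measure_ball_pos volume _ (norm_pos_iff.2 hx)
  have hbdd : BddAbove {τ : ℝ | 0 < τ ∧ x ∈ schwarzSymm {y | τ < |f y|}} := by
    have htend := tendsto_measure_iInter_atTop (μ := volume)
      (s := fun j : ℕ => {y | (j : ℝ) + 1 < |f y|})
      (fun j => (measurableSet_lt measurable_const hf.abs).nullMeasurableSet)
      (fun i j hij y hy => by
        have h1 : (i : ℝ) ≤ j := by exact_mod_cast hij
        have h2 : (j : ℝ) + 1 < |f y| := hy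
        exact (by linarith : (i : ℝ) + 1 < |f y|))
      ⟨0, (hfin _ (by positivity)).ne⟩
    have h0 : ⋂ j : ℕ, {y | (j : ℝ) + 1 < |f y|} = ∅ := by
      refine eq_empty_of_forall_notMem fun y hy => ?_
      obtain ⟨j, hj⟩ := exists_nat_gt |f y|
      have h1 : (j : ℝ) + 1 < |f y| := mem_iInter.1 hy j
      linarith
    rw [h0, measure_empty] at htend
    obtain ⟨j, hj⟩ := (htend.eventually_lt_const hpos).exists
    refine ⟨(j : ℝ) + 1, fun τ hτ => ?_⟩
    by_contra! hlt
    exact absurd ((mem_schwarzSymm_iff hm).1 hτ.2)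
      (not_lt.2 ((hmono hlt.le).trans hj.le))
  constructor
  · intro h
    have hne : {τ : ℝ | 0 < τ ∧ x ∈ schwarzSymm {y | τ < |f y|}}.Nonempty := by
      by_contra hne
      rw [symmDecrRearr, not_nonempty_iff_eq_empty.1 hne, Real.sSup_empty] at h
      linarith
    obtain ⟨τ, hτ, hστ⟩ := exists_lt_of_lt_csSup hne h
    exact (mem_schwarzSymm_iff hm).2 (((mem_schwarzSymm_iff hm).1 hτ.2).trans_le (hmono hστ.le))
  · intro h
    rw [mem_schwarzSymm_iff hm] at h
    have hun : ⋃ j : ℕ, {y | σ + 1 / ((j : ℝ) + 1) < |f y|} = {y | σ < |f y|} := by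
      ext y
      simp only [mem_iUnion, mem_ofPred_eq]
      constructor
      · rintro ⟨j, hj⟩
        have : 0 < 1 / ((j : ℝ) + 1) := by positivity
        linarith
      · intro hy
        obtain ⟨j, hj⟩ := exists_nat_one_div_lt (sub_pos.2 hy)
        exact ⟨j, by linarith⟩
    have htend := tendsto_measure_iUnion_atTop (μ := volume)
      (s := fun j : ℕ => {y | σ + 1 / ((j : ℝ) + 1) < |f y|}) (fun i j hij y hy => by
        have h1 : 1 / ((j : ℝ) + 1) ≤ 1 / ((i : ℝ) + 1) := Nat.one_div_le_one_div hij
        have h2 : σ + 1 / ((i : ℝ) + 1) < |f y| := hy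
        exact (by linarith : σ + 1 / ((j : ℝ) + 1) < |f y|))
    rw [hun] at htend
    obtain ⟨j, hj⟩ := (htend.eventually_const_lt h).exists
    have hp : 0 < 1 / ((j : ℝ) + 1) := by positivity
    exact (by linarith : σ < σ + 1 / ((j : ℝ) + 1)).trans_le
      (le_csSup hbdd ⟨by linarith, (mem_schwarzSymm_iff hm).2 hj⟩)

theorem superlevel_symmDecrRearr_ae_eq (hm : 1 ≤ m) (hf : Measurable f)
    (hfin : ∀ τ : ℝ, 0 < τ → volume {x | τ < |f x|} < ⊤) {σ : ℝ} (hσ : 0 < σ) :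
    ({x | σ < symmDecrRearr f x} : Set (EuclideanSpace ℝ (Fin m))) =ᵐ[volume]
      schwarzSymm {y | σ < |f y|} := by
  have := nontrivial_euclideanSpace hm
  have h0 : ∀ᵐ x : EuclideanSpace ℝ (Fin m), x ≠ 0 := by
    simp [ae_iff]
  exact Filter.eventuallyEq_set.2
    (h0.mono fun x hx => lt_symmDecrRearr_iff hm hf hfin hσ hx)

theorem measurable_symmDecrRearr (hm : 1 ≤ m) (hf : Measurable f)
    (hfin : ∀ τ : ℝ, 0 < τ → volume {x | τ < |f x|} < ⊤) : Measurable (symmDecrRearr f) := by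
  have hpos : ∀ σ : ℝ, 0 < σ → MeasurableSet {x | σ < symmDecrRearr f x} := by
    intro σ hσ
    have h1 : {x | σ < symmDecrRearr f x} \ {0} = schwarzSymm {y | σ < |f y|} \ {0} := by
      ext x
      simp only [mem_sdiff, mem_ofPred_eq, mem_singleton_iff]
      exact and_congr_left fun hx => lt_symmDecrRearr_iff hm hf hfin hσ hx
    rw [← sdiff_union_inter {x | σ < symmDecrRearr f x} {0}, h1]
    exact ((measurableSet_schwarzSymm _).diff (measurableSet_singleton _)).union
      ((finite_singleton _).subset inter_subset_right).measurableSet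
  refine measurable_of_Ioi fun σ => ?_
  change MeasurableSet {x | σ < symmDecrRearr f x}
  rcases lt_trichotomy σ 0 with h | h | h
  · convert MeasurableSet.univ
    exact eq_univ_of_forall fun x => h.trans_le (symmDecrRearr_nonneg f x)
  · have : {x | σ < symmDecrRearr f x} =
        ⋃ j : ℕ, {x | 1 / ((j : ℝ) + 1) < symmDecrRearr f x} := by
      ext x
      simp only [mem_iUnion, mem_ofPred_eq, h]
      exact ⟨exists_nat_one_div_lt, fun ⟨j, hj⟩ => lt_trans (by positivity) hj⟩
    rw [this]
    exact MeasurableSet.iUnion fun j => hpos _ (by positivity)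
  · exact hpos σ h

theorem ball_ae_eq_ball {E : Type*} [NormedAddCommGroup E] [InnerProductSpace ℝ E]
    [FiniteDimensional ℝ E] [MeasurableSpace E] [BorelSpace E] {c : E} {r s : ℝ}
    (h : volume (Metric.ball c r) = volume (Metric.ball c s)) :
    Metric.ball c r =ᵐ[volume] Metric.ball c s := by
  rcases le_total r s with hrs | hrs
  · exact ae_eq_of_subset_of_measure_ge (Metric.ball_subset_ball hrs) h.ge
      measurableSet_ball.nullMeasurableSet measure_ball_lt_top.ne
  · exact (ae_eq_of_subset_of_measure_ge (Metric.ball_subset_ball hrs) h.le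
      measurableSet_ball.nullMeasurableSet measure_ball_lt_top.ne).symm

end Rearrangement

/-! ### Interaction with a complement -/

section SetEnergy

variable {E : Type*} [NormedAddCommGroup E] [InnerProductSpace ℝ E] [FiniteDimensional ℝ E]
  [MeasurableSpace E] [BorelSpace E] {K : E → ℝ≥0∞}

theorem interaction_congr {A A' B B' : Set E} (hA : A =ᵐ[volume] A') (hB : B =ᵐ[volume] B') :
    interaction K A B = interaction K A' B' := by
  refine lintegral_congr_ae (hA.mem_iff.mono fun x hx => lintegral_congr_ae
    (hB.mem_iff.mono fun y hy => ?_))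
  by_cases hxA : x ∈ A' <;> by_cases hyB : y ∈ B' <;> simp [hx, hy, hxA, hyB]

theorem interaction_add_interaction_compl (hK : IsRadialKernel K) {A B : Set E}
    (hA : MeasurableSet A) (hB : MeasurableSet B) :
    interaction K A B + interaction K A Bᶜ = volume A * ∫⁻ x, K x := by
  unfold interaction
  rw [← lintegral_add_left
    (measurable_interaction_integrand hK.measurable hA hB).lintegral_prod_right',
    ← lintegral_indicator_one hA, ← lintegral_mul_const _ (measurable_indicator_one hA)]
  refine lintegral_congr fun x => ?_
  have m : Measurable fun y => A.indicator (1 : E → ℝ≥0∞) x * B.indicator 1 y * K (x - y) :=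
    (measurable_interaction_integrand hK.measurable hA hB).comp measurable_prodMk_left
  change (∫⁻ y, A.indicator 1 x * B.indicator 1 y * K (x - y)) + _ = _
  rw [← lintegral_add_left m, ← lintegral_sub_left_eq_self K x,
    ← lintegral_const_mul' _ _ (by by_cases hx : x ∈ A <;> simp [hx])]
  refine lintegral_congr fun y => ?_
  by_cases hy : y ∈ B <;> simp [hy]

theorem interaction_ball_center (c : E) (r s : ℝ) :
    interaction K (Metric.ball c r) (Metric.ball c s) =
      interaction K (Metric.ball 0 r) (Metric.ball 0 s) := by
  unfold interaction
  rw [← lintegral_add_right_eq_self _ c]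
  refine lintegral_congr fun x => ?_
  rw [← lintegral_add_right_eq_self _ c]
  refine lintegral_congr fun y => ?_
  simp [indicator, dist_eq_norm]

/-- Two sets are, up to null sets, balls with the same center, unless one of them is null. -/
def Concentric (A B : Set E) : Prop :=
  volume A = 0 ∨ volume B = 0 ∨
    ∃ (c : E) (r s : ℝ), A =ᵐ[volume] Metric.ball c r ∧ B =ᵐ[volume] Metric.ball c s

variable [Nontrivial E] {A B : Set E} {r s : ℝ}

theorem interaction_eq_iff_concentric (hK : IsRadialKernel K)
    (hKs : ∀ x y, ‖x‖ < ‖y‖ → K y < K x) (hA : MeasurableSet A) (hB : MeasurableSet B)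
    (hAr : volume A = volume (Metric.ball (0 : E) r))
    (hBs : volume B = volume (Metric.ball (0 : E) s)) :
    interaction K A B = interaction K (Metric.ball 0 r) (Metric.ball 0 s) ↔ Concentric A B := by
  constructor
  · intro h
    by_cases hA0 : volume A = 0
    · exact .inl hA0
    by_cases hB0 : volume B = 0
    · exact .inr (.inl hB0)
    exact .inr (.inr (exists_ae_eq_ball_of_interaction_eq hK hKs hA hB hA0 hB0 hAr hBs h.ge))
  · have hz : ∀ {A B : Set E}, MeasurableSet A → volume A = 0 → interaction K A B = 0 :=
      fun hA h => nonpos_iff_eq_zero.1 ((interaction_le hK hA).trans_eq (by rw [h, zero_mul]))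
    rintro (h | h | ⟨c, r', s', hr', hs'⟩)
    · rw [hz hA h, hz measurableSet_ball (hAr ▸ h)]
    · rw [interaction_comm hK hA hB, interaction_comm hK measurableSet_ball measurableSet_ball,
        hz hB h, hz measurableSet_ball (hBs ▸ h)]
    · rw [interaction_congr hr' hs', interaction_ball_center]
      refine interaction_congr (ball_ae_eq_ball ?_) (ball_ae_eq_ball ?_)
      · rw [← hAr, measure_congr hr', Measure.addHaar_ball_center volume c]
      · rw [← hBs, measure_congr hs', Measure.addHaar_ball_center volume c]

/-- Interactions of `A` with `B` and with `Bᶜ` add up to `|A| ∫ K`, which rearrangement preserves.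
Finiteness allows cancellation, and Riesz's inequality is reversed. -/
theorem interaction_compl_ball_le (hK : IsRadialKernel K) (hA : MeasurableSet A)
    (hB : MeasurableSet B) (hAr : volume A = volume (Metric.ball (0 : E) r))
    (hBs : volume B = volume (Metric.ball (0 : E) s)) :
    interaction K (Metric.ball 0 r) (Metric.ball 0 s)ᶜ ≤ interaction K A Bᶜ := by
  have hAf : volume A ≠ ∞ := hAr ▸ measure_ball_lt_top.ne
  have h1 := interaction_add_interaction_compl hK hA hB
  rw [hAr, ← interaction_add_interaction_compl hK measurableSet_ball
    (measurableSet_ball (x := 0) (ε := s))] at h1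
  refine (ENNReal.add_le_add_iff_left (interaction_ne_top hK hA hAf (B := B))).1 ?_
  rw [h1]
  gcongr
  exact interaction_le_interaction_ball hK hA hB hAr hBs

theorem interaction_compl_eq_iff_concentric (hK : IsRadialKernel K)
    (hKs : ∀ x y, ‖x‖ < ‖y‖ → K y < K x) (hA : MeasurableSet A) (hB : MeasurableSet B)
    (hAr : volume A = volume (Metric.ball (0 : E) r))
    (hBs : volume B = volume (Metric.ball (0 : E) s)) :
    interaction K (Metric.ball 0 r) (Metric.ball 0 s)ᶜ = interaction K A Bᶜ ↔
      Concentric A B := by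
  rw [← interaction_eq_iff_concentric hK hKs hA hB hAr hBs]
  have hAf : volume A ≠ ∞ := hAr ▸ measure_ball_lt_top.ne
  have h1 := interaction_add_interaction_compl hK hA hB
  rw [hAr, ← interaction_add_interaction_compl hK measurableSet_ball
    (measurableSet_ball (x := 0) (ε := s))] at h1
  constructor
  · intro h
    rw [h] at h1
    exact (ENNReal.add_left_inj (interaction_ne_top hK hA hAf)).1 h1
  · intro h
    rw [h] at h1
    exact ((ENNReal.add_right_inj
      (interaction_ne_top hK measurableSet_ball measure_ball_lt_top.ne)).1 h1).symm

end SetEnergy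

/-! ### Layer cake decomposition of a convex function -/

section LayerMeasure

/-- `ν` is the second derivative on `[0, ∞)` of the convex function `J`, including the mass at the
origin that accounts for the right derivative of `J` there. -/
structure IsLayerMeasure (J : ℝ → ℝ) (ν : Measure ℝ) : Prop where
  measure_Iio_zero : ν (Iio 0) = 0
  lintegral_eq : ∀ t, 0 ≤ t → ENNReal.ofReal (J t) = ∫⁻ u in Ioo 0 t, ν (Iio u)

theorem isLayerMeasure_abs {J : ℝ → ℝ} (hJ : ∀ t, J t = |t|) :
    IsLayerMeasure J (Measure.dirac 0) where
  measure_Iio_zero := by simp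
  lintegral_eq t ht := by
    have h : ∀ u ∈ Ioo 0 t, Measure.dirac (0 : ℝ) (Iio u) = 1 := fun u hu => by
      simp [hu.1]
    rw [setLIntegral_congr_fun measurableSet_Ioo h]
    simp [hJ, abs_of_nonneg ht]

theorem rightDeriv_nonneg {J : ℝ → ℝ} (hJ_nonneg : ∀ t, 0 ≤ J t) (hJ_convex : ConvexOn ℝ univ J)
    (hJ_zero : J 0 = 0) {u : ℝ} (hu : 0 ≤ u) : 0 ≤ derivWithin J (Ioi u) u := by
  have hint : ∀ x : ℝ, x ∈ interior (univ : Set ℝ) := by simp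
  refine le_trans ?_ (hJ_convex.monotoneOn_rightDeriv (hint 0) (hint u) hu)
  dsimp only
  rw [hJ_convex.rightDeriv_eq_sInf_slope_of_mem_interior (hint 0)]
  refine Real.sInf_nonneg ?_
  rintro _ ⟨y, ⟨-, hy⟩, rfl⟩
  rw [slope_def_field, hJ_zero, sub_zero, sub_zero]
  exact div_nonneg (hJ_nonneg y) hy.le

/-- `ν` is the Stieltjes measure of the right derivative of `J`, set to zero on the negative
half-line so that its jump at the origin becomes a mass. Thus `ν (Iio u)` is the left limit of the
derivative, and integration recovers `J`. Strict convexity makes the derivative strictly increasing.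
-/
theorem exists_isLayerMeasure {J : ℝ → ℝ} (hJ_nonneg : ∀ t, 0 ≤ J t)
    (hJ_convex : ConvexOn ℝ univ J) (hJ_zero : J 0 = 0) :
    ∃ ν : Measure ℝ, SFinite ν ∧ IsLayerMeasure J ν ∧
      (StrictConvexOn ℝ univ J → ∀ a b, 0 < a → a < b → ν (Ioo a b) ≠ 0) := by
  have hint : ∀ x : ℝ, x ∈ interior (univ : Set ℝ) := by simp
  let G : ℝ → ℝ := fun u => if u < 0 then 0 else derivWithin J (Ioi u) u
  have hG0 : ∀ u, 0 ≤ G u := fun u => by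
    simp only [G]
    split_ifs with h
    · exact le_rfl
    · exact rightDeriv_nonneg hJ_nonneg hJ_convex hJ_zero (not_lt.1 h)
  have hGeq : ∀ u, 0 ≤ u → G u = derivWithin J (Ioi u) u := fun u hu => if_neg (not_lt.2 hu)
  have hG : Monotone G := by
    intro u v huv
    rcases lt_or_ge u 0 with h | h
    · have : G u = 0 := if_pos h
      rw [this]; exact hG0 v
    · rw [hGeq u h, hGeq v (h.trans huv)]
      exact hJ_convex.monotoneOn_rightDeriv (hint u) (hint v) huv
  let sf := hG.stieltjesFunction
  have hsfl : ∀ u, Function.leftLim sf u = Function.leftLim G u := fun u =>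
    leftLim_rightLim (hG.tendsto_leftLim u)
  have hl0 : Function.leftLim G 0 = 0 := by
    refine leftLim_eq_of_tendsto ?_
    refine tendsto_const_nhds.congr' ?_
    filter_upwards [self_mem_nhdsWithin] with u hu
    exact (if_pos hu).symm
  have hIio : ∀ u, 0 < u → (sf.measure.restrict (Ici 0)) (Iio u) =
      ENNReal.ofReal (Function.leftLim G u) := by
    intro u hu
    rw [Measure.restrict_apply measurableSet_Iio, inter_comm, Ici_inter_Iio, sf.measure_Ico, hsfl,
      hsfl, hl0, sub_zero]
  refine ⟨sf.measure.restrict (Ici 0), inferInstance, ⟨?_, fun t ht => ?_⟩, fun hs a b ha hab => ?_⟩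
  · rw [Measure.restrict_apply measurableSet_Iio, (Iio_disjoint_Ici le_rfl).inter_eq, measure_empty]
  · have hint' : IntervalIntegrable G volume 0 t := hG.intervalIntegrable
    have hftc : ∫ u in (0 : ℝ)..t, G u = J t := by
      rw [intervalIntegral.integral_eq_sub_of_hasDeriv_right_of_le (f := J) ht
        (hJ_convex.continuousOn isOpen_univ |>.mono (subset_univ _)) (fun x hx => ?_) hint', hJ_zero,
        sub_zero]
      rw [hGeq x hx.1.le]
      exact hJ_convex.hasDerivWithinAt_rightDeriv_of_mem_interior (hint x)
    rw [← hftc, intervalIntegral.integral_of_le ht, integral_Ioc_eq_integral_Ioo,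
      ofReal_integral_eq_lintegral_ofReal
        (((intervalIntegrable_iff_integrableOn_Ioo_of_le ht).1 hint'))
        (.of_forall hG0)]
    -- The left limit differs from `G` only at the countably many jumps.
    have hc : ∀ᵐ u : ℝ, ContinuousAt G u :=
      hG.countable_not_continuousAt.measure_zero volume
    refine setLIntegral_congr_fun_ae measurableSet_Ioo (hc.mono fun u hcu hu => ?_)
    rw [hIio u hu.1, hcu.continuousWithinAt.leftLim_eq]
  -- Two intermediate points separate the right limit at `a` from the left limit at `b`.
  · obtain ⟨a', ha', hab'⟩ := exists_between hab
    obtain ⟨b', hb', hbb'⟩ := exists_between hab'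
    have hsub : Ioo a b ⊆ Ici (0 : ℝ) := fun x hx => (ha.trans hx.1).le
    rw [Measure.restrict_apply measurableSet_Ioo, inter_eq_left.2 hsub, sf.measure_Ioo, hsfl]
    have h1 : sf a ≤ G a' := hG.rightLim_le ha'
    have h2 : G b' ≤ Function.leftLim G b := hG.le_leftLim hbb'
    have h3 : G a' < G b' := by
      have hd := hs.convexOn
      rw [hGeq a' (ha.trans ha').le, hGeq b' (ha.trans (ha'.trans hb')).le]
      calc derivWithin J (Ioi a') a' < slope J a' b' := hs.rightDeriv_lt_slope trivial trivial hb'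
            (hd.differentiableWithinAt_Ioi_of_mem_interior (hint a'))
        _ ≤ derivWithin J (Iio b') b' := hd.slope_le_leftDeriv_of_mem_interior trivial (hint b') hb'
        _ ≤ derivWithin J (Ioi b') b' := hd.leftDeriv_le_rightDeriv_of_mem_interior (hint b')
    exact (ENNReal.ofReal_pos.2 (by linarith)).ne'

/-- The layer cake decomposition of `J (a - b)` for `a ≥ b`. -/
theorem IsLayerMeasure.lintegral_layer {J : ℝ → ℝ} {ν : Measure ℝ} (hν : IsLayerMeasure J ν)
    {a b : ℝ} (hb : 0 ≤ b) :
    ∫⁻ τ in Ioi (0 : ℝ), ∫⁻ s, (Iio a).indicator 1 (τ + s) * (Ici b).indicator 1 τ ∂ν =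
      if b ≤ a then ENNReal.ofReal (J (a - b)) else 0 := by
  have h1 : ∀ τ, ∫⁻ s, (Iio a).indicator (1 : ℝ → ℝ≥0∞) (τ + s) * (Ici b).indicator 1 τ ∂ν =
      ν (Iio (a - τ)) * (Ici b).indicator 1 τ := by
    intro τ
    rw [lintegral_mul_const' _ _ (by by_cases h : τ ∈ Ici b <;> simp [h]),
      ← lintegral_indicator_one measurableSet_Iio]
    congr 1
    refine lintegral_congr fun s => ?_
    simp only [indicator, mem_Iio, lt_sub_iff_add_lt, add_comm]
    rfl
  have hz : ∀ u ≤ 0, ν (Iio u) = 0 := fun u hu =>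
    measure_mono_null (Iio_subset_Iio hu) hν.measure_Iio_zero
  simp_rw [h1]
  rw [← lintegral_indicator measurableSet_Ioi, ← lintegral_sub_left_eq_self _ a]
  -- After the substitution `u = a - τ`, the range of integration differs from `Ioo 0 (a - b)` only
  -- by this endpoint; for `u ≤ 0` the integrand vanishes.
  have hne : ∀ᵐ u : ℝ, u ≠ a - b := by simp [ae_iff]
  split_ifs with hab
  · rw [hν.lintegral_eq _ (sub_nonneg.2 hab), ← lintegral_indicator measurableSet_Ioo]
    refine lintegral_congr_ae (hne.mono fun u hu => ?_)
    simp only [indicator, mem_Ioi, mem_Ici, mem_Ioo, sub_sub_cancel, Pi.one_apply]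
    rcases le_or_gt u 0 with h0 | h0
    · simp [hz u h0]
    · rcases lt_or_gt_of_ne hu with h | h
      · simp [h0, h, (by linarith : u < a), (by linarith : b ≤ a - u)]
      · simp [not_lt.2 h.le, (by linarith : ¬ b ≤ a - u)]
  · refine (lintegral_congr fun u => ?_).trans lintegral_zero
    simp only [indicator, mem_Ioi, mem_Ici, sub_sub_cancel, Pi.one_apply]
    rcases le_or_gt u 0 with h0 | h0
    · simp [hz u h0]
    · simp [(by linarith : ¬ b ≤ a - u)]

/-- Only the term matching the sign of `a - b` contributes. For `a = b` both are `J 0 = 0`, so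
nothing is counted twice. -/
theorem ofReal_eq_layer_add_layer {J : ℝ → ℝ} (hJ_zero : J 0 = 0) {ν ν' : Measure ℝ}
    (hν : IsLayerMeasure J ν) (hν' : IsLayerMeasure (fun t => J (-t)) ν') {a b : ℝ} (ha : 0 ≤ a)
    (hb : 0 ≤ b) :
    ENNReal.ofReal (J (a - b)) =
      (∫⁻ τ in Ioi (0 : ℝ), ∫⁻ s, (Iio a).indicator 1 (τ + s) * (Ici b).indicator 1 τ ∂ν) +
        ∫⁻ τ in Ioi (0 : ℝ), ∫⁻ s, (Iio b).indicator 1 (τ + s) * (Ici a).indicator 1 τ ∂ν' := by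
  rw [hν.lintegral_layer hb, hν'.lintegral_layer ha]
  rcases lt_trichotomy a b with h | h | h
  · simp [not_le.2 h, h.le]
  · simp [h, hJ_zero]
  · simp [not_le.2 h, h.le]

end LayerMeasure

/-! ### The energy of level sets -/

section LayerEnergy

variable {E : Type*} [NormedAddCommGroup E] [InnerProductSpace ℝ E] [FiniteDimensional ℝ E]
  [MeasurableSpace E] [BorelSpace E] {K : E → ℝ≥0∞}

/-- The part of the energy where the first function is larger, in terms of superlevel sets. -/
noncomputable def layerEnergy (K : E → ℝ≥0∞) (ν : Measure ℝ) (f g : E → ℝ) : ℝ≥0∞ :=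
  ∫⁻ τ in Ioi (0 : ℝ), ∫⁻ s, interaction K {x | τ + s < f x} {x | τ < g x}ᶜ ∂ν

theorem measurable_layer_integrand (hK : Measurable K) {f g : E → ℝ} (hf : Measurable f)
    (hg : Measurable g) : Measurable fun q : (ℝ × ℝ) × (E × E) =>
      (Iio (f q.2.1)).indicator (1 : ℝ → ℝ≥0∞) (q.1.1 + q.1.2) *
        (Ici (g q.2.2)).indicator 1 q.1.1 * K (q.2.1 - q.2.2) := by
  have h1 : Measurable fun q : (ℝ × ℝ) × (E × E) =>
      (Iio (f q.2.1)).indicator (1 : ℝ → ℝ≥0∞) (q.1.1 + q.1.2) := by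
    have : MeasurableSet {q : (ℝ × ℝ) × (E × E) | q.1.1 + q.1.2 < f q.2.1} :=
      measurableSet_lt (by fun_prop) (by fun_prop)
    exact (measurable_one (α := ℝ≥0∞)).indicator this
  have h2 : Measurable fun q : (ℝ × ℝ) × (E × E) =>
      (Ici (g q.2.2)).indicator (1 : ℝ → ℝ≥0∞) q.1.1 := by
    have : MeasurableSet {q : (ℝ × ℝ) × (E × E) | g q.2.2 ≤ q.1.1} :=
      measurableSet_le (by fun_prop) (by fun_prop)
    exact (measurable_one (α := ℝ≥0∞)).indicator this
  exact (h1.mul h2).mul (by fun_prop)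

theorem indicator_layer (f g : E → ℝ) (τ s : ℝ) (x y : E) :
    (Iio (f x)).indicator (1 : ℝ → ℝ≥0∞) (τ + s) * (Ici (g y)).indicator 1 τ * K (x - y) =
      {x | τ + s < f x}.indicator 1 x * {x | τ < g x}ᶜ.indicator 1 y * K (x - y) := by
  simp [indicator]

theorem lintegral_layer_integrand (hK : Measurable K) {f g : E → ℝ} (hf : Measurable f)
    (hg : Measurable g) (τ s : ℝ) :
    ∫⁻ z : E × E, (Iio (f z.1)).indicator (1 : ℝ → ℝ≥0∞) (τ + s) * (Ici (g z.2)).indicator 1 τ *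
      K (z.1 - z.2) ∂(volume.prod volume) = interaction K {x | τ + s < f x} {x | τ < g x}ᶜ := by
  unfold interaction
  simp_rw [← indicator_layer]
  have m := (measurable_layer_integrand hK hf hg).comp
    (measurable_prodMk_left (x := ((τ, s) : ℝ × ℝ)))
  exact lintegral_prod _ m.aemeasurable

theorem measurable_interaction_layer (hK : Measurable K) {f g : E → ℝ} (hf : Measurable f)
    (hg : Measurable g) :
    Measurable fun p : ℝ × ℝ => interaction K {x | p.1 + p.2 < f x} {x | p.1 < g x}ᶜ := by
  have h := (measurable_layer_integrand hK hf hg).lintegral_prod_right' (ν := volume.prod volume)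
  simp_rw [← lintegral_layer_integrand hK hf hg]
  exact h

/-- Tonelli: the levels are moved outside the integrals over the points. -/
theorem lintegral_layer_eq_layerEnergy (hK : Measurable K) {ν : Measure ℝ} [SFinite ν]
    {f g : E → ℝ} (hf : Measurable f) (hg : Measurable g) :
    ∫⁻ x, ∫⁻ y, (∫⁻ τ in Ioi (0 : ℝ), ∫⁻ s,
      (Iio (f x)).indicator 1 (τ + s) * (Ici (g y)).indicator 1 τ ∂ν) * K (x - y) =
      layerEnergy K ν f g := by
  have mΦ := measurable_layer_integrand hK hf hg
  have mφ : ∀ a b : ℝ, Measurable fun p : ℝ × ℝ =>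
      (Iio a).indicator (1 : ℝ → ℝ≥0∞) (p.1 + p.2) * (Ici b).indicator 1 p.1 := fun a b =>
    (((measurable_one (α := ℝ≥0∞)).indicator measurableSet_Iio).comp
      (measurable_fst.add measurable_snd)).mul
      (((measurable_one (α := ℝ≥0∞)).indicator measurableSet_Ici).comp measurable_fst)
  have h1 : ∀ x y, (∫⁻ τ in Ioi (0 : ℝ), ∫⁻ s,
      (Iio (f x)).indicator 1 (τ + s) * (Ici (g y)).indicator 1 τ ∂ν) * K (x - y) =
      ∫⁻ p : ℝ × ℝ, (Iio (f x)).indicator 1 (p.1 + p.2) * (Ici (g y)).indicator 1 p.1 *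
        K (x - y) ∂((volume.restrict (Ioi 0)).prod ν) := fun x y => by
    rw [lintegral_mul_const _ (mφ _ _), lintegral_prod _ (mφ _ _).aemeasurable]
  simp_rw [h1]
  rw [lintegral_lintegral (f := fun x y => ∫⁻ p : ℝ × ℝ, (Iio (f x)).indicator 1 (p.1 + p.2) *
    (Ici (g y)).indicator 1 p.1 * K (x - y) ∂((volume.restrict (Ioi 0)).prod ν))
    (mΦ.lintegral_prod_left' (μ := (volume.restrict (Ioi 0)).prod ν)).aemeasurable]
  rw [lintegral_lintegral_swap (f := fun (z : E × E) (p : ℝ × ℝ) =>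
    (Iio (f z.1)).indicator 1 (p.1 + p.2) * (Ici (g z.2)).indicator 1 p.1 * K (z.1 - z.2))
    (mΦ.comp measurable_swap).aemeasurable]
  simp_rw [lintegral_layer_integrand hK hf hg]
  rw [lintegral_prod _ (measurable_interaction_layer hK hf hg).aemeasurable]
  rfl

end LayerEnergy

/-! ### The kernel as a monotone function of the norm -/

section Kernel

variable {m : ℕ} {k : EuclideanSpace ℝ (Fin m) → ℝ}

/-- The kernel with values in `[0, ∞]`, with the value at the origin made infinite so that it
becomes monotone. -/
noncomputable def radialKernel (k : EuclideanSpace ℝ (Fin m) → ℝ) (x : EuclideanSpace ℝ (Fin m)) :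
    ℝ≥0∞ :=
  open Classical in if x = 0 then ∞ else ENNReal.ofReal (k x)

theorem radialKernel_of_ne_zero {x : EuclideanSpace ℝ (Fin m)} (hx : x ≠ 0) :
    radialKernel k x = ENNReal.ofReal (k x) := if_neg hx

theorem radialKernel_anti (hk : IsSymmDecr k) (x y : EuclideanSpace ℝ (Fin m)) (h : ‖x‖ ≤ ‖y‖) :
    radialKernel k y ≤ radialKernel k x := by
  by_cases hx : x = 0
  · have : radialKernel k x = ∞ := if_pos hx
    rw [this]; exact le_top
  · have hy : y ≠ 0 := norm_pos_iff.1 ((norm_pos_iff.2 hx).trans_le h)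
    rw [radialKernel_of_ne_zero hx, radialKernel_of_ne_zero hy]
    exact ENNReal.ofReal_le_ofReal (hk x y hx h)

/-- Borel measurability comes from monotonicity: the kernel is an antitone function on the line
composed with the norm. -/
theorem isRadialKernel_radialKernel (hm : 1 ≤ m) (hk_int : Integrable k volume)
    (hk : IsSymmDecr k) : IsRadialKernel (radialKernel k) := by
  have := nontrivial_euclideanSpace hm
  have hanti := radialKernel_anti hk
  refine ⟨?_, hanti, ?_⟩
  · obtain ⟨e, he⟩ := exists_norm_eq (EuclideanSpace ℝ (Fin m)) zero_le_one
    have hφ : Antitone fun r : ℝ => radialKernel k (max r 0 • e) := fun r r' h => by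
      refine hanti _ _ ?_
      rw [norm_smul, norm_smul, he, Real.norm_of_nonneg (le_max_right _ _),
        Real.norm_of_nonneg (le_max_right _ _)]
      gcongr
    have heq : radialKernel k = (fun r : ℝ => radialKernel k (max r 0 • e)) ∘ norm := by
      funext x
      have hn : ‖max ‖x‖ 0 • e‖ = ‖x‖ := by
        rw [norm_smul, he, mul_one, Real.norm_of_nonneg (le_max_right _ _),
          max_eq_left (norm_nonneg x)]
      exact le_antisymm (hanti _ _ hn.le) (hanti _ _ hn.ge)
    rw [heq]
    exact hφ.measurable.comp measurable_norm
  · have h0 : ∀ᵐ x : EuclideanSpace ℝ (Fin m), x ≠ 0 := by simp [ae_iff]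
    rw [lintegral_congr_ae (h0.mono fun x hx => radialKernel_of_ne_zero hx)]
    exact hk_int.lintegral_lt_top.ne

/-- A negative value would bound `k` away from zero outside a ball, contradicting integrability. -/
theorem IsSymmDecr.nonneg (hm : 1 ≤ m) (hk_int : Integrable k volume) (hk : IsSymmDecr k)
    {x : EuclideanSpace ℝ (Fin m)} (hx : x ≠ 0) : 0 ≤ k x := by
  have := nontrivial_euclideanSpace hm
  by_contra! hneg
  have h1 := hk_int.measure_norm_ge_lt_top (ε := -k x) (by linarith)
  have h2 : (Metric.ball (0 : EuclideanSpace ℝ (Fin m)) ‖x‖)ᶜ ⊆ {y | -k x ≤ ‖k y‖} := by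
    intro y hy
    have hy' : ‖x‖ ≤ ‖y‖ := by simpa using hy
    have := hk x y hx hy'
    have h3 := neg_abs_le (k y)
    have h4 : k y < 0 := by linarith
    simp only [mem_ofPred_eq, Real.norm_eq_abs, abs_of_neg h4]
    linarith
  have h3 : volume (univ : Set (EuclideanSpace ℝ (Fin m))) = ∞ :=
    measure_univ_of_isAddLeftInvariant volume
  rw [← union_compl_self (Metric.ball (0 : EuclideanSpace ℝ (Fin m)) ‖x‖)] at h3
  exact absurd h3 ((measure_union_le _ _).trans_lt (ENNReal.add_lt_top.2
    ⟨measure_ball_lt_top, (measure_mono h2).trans_lt h1⟩)).ne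

theorem radialKernel_strict_anti (hm : 1 ≤ m) (hk_int : Integrable k volume) (hk : IsSymmDecr k)
    (hks : IsStrictSymmDecr k) (x y : EuclideanSpace ℝ (Fin m)) (h : ‖x‖ < ‖y‖) :
    radialKernel k y < radialKernel k x := by
  have hy : y ≠ 0 := norm_pos_iff.1 ((norm_nonneg x).trans_lt h)
  rw [radialKernel_of_ne_zero hy]
  by_cases hx : x = 0
  · have : radialKernel k x = ∞ := if_pos hx
    rw [this]; exact ENNReal.ofReal_lt_top
  · rw [radialKernel_of_ne_zero hx]
    have h1 := hks x y hx h
    exact (ENNReal.ofReal_lt_ofReal_iff ((hk.nonneg hm hk_int hy).trans_lt h1)).2 h1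

end Kernel

/-! ### The rearrangement inequality and its equality case by levels -/

section Energy

variable {m : ℕ} {J : ℝ → ℝ} {k f g : EuclideanSpace ℝ (Fin m) → ℝ} {ν ν' : Measure ℝ}

theorem measurable_layer {E : Type*} [NormedAddCommGroup E] [InnerProductSpace ℝ E]
    [FiniteDimensional ℝ E] [MeasurableSpace E] [BorelSpace E] {ν : Measure ℝ} [SFinite ν]
    {f g : E → ℝ} (hf : Measurable f) (hg : Measurable g) :
    Measurable fun z : E × E => ∫⁻ τ in Ioi (0 : ℝ), ∫⁻ s,
      (Iio (f z.1)).indicator (1 : ℝ → ℝ≥0∞) (τ + s) * (Ici (g z.2)).indicator 1 τ ∂ν := by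
  have h := (measurable_layer_integrand (K := fun _ : E => 1) measurable_const hf
    hg).lintegral_prod_left' (μ := (volume.restrict (Ioi (0 : ℝ))).prod ν)
  have mφ : ∀ a b : ℝ, Measurable fun p : ℝ × ℝ =>
      (Iio a).indicator (1 : ℝ → ℝ≥0∞) (p.1 + p.2) * (Ici b).indicator 1 p.1 := fun a b =>
    (((measurable_one (α := ℝ≥0∞)).indicator measurableSet_Iio).comp
      (measurable_fst.add measurable_snd)).mul
      (((measurable_one (α := ℝ≥0∞)).indicator measurableSet_Ici).comp measurable_fst)
  convert h using 2 with z
  simp_rw [mul_one]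
  rw [lintegral_prod _ (mφ _ _).aemeasurable]

theorem nonlocalEnergy_eq_layerEnergy_add [SFinite ν] [SFinite ν'] (hm : 1 ≤ m)
    (hJ_nonneg : ∀ t, 0 ≤ J t) (hJ_zero : J 0 = 0) (hk_int : Integrable k volume)
    (hk : IsSymmDecr k) (hν : IsLayerMeasure J ν) (hν' : IsLayerMeasure (fun t => J (-t)) ν')
    (hf : Measurable f) (hg : Measurable g) (hf0 : ∀ x, 0 ≤ f x) (hg0 : ∀ x, 0 ≤ g x) :
    nonlocalEnergy J k f g =
      layerEnergy (radialKernel k) ν f g + layerEnergy (radialKernel k) ν' g f := by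
  have := nontrivial_euclideanSpace hm
  have hK := isRadialKernel_radialKernel hm hk_int hk
  have mK := hK.measurable
  have m1 := measurable_layer (ν := ν) hf hg
  have m2 := measurable_layer (ν := ν') hg hf
  have m1' : Measurable fun z : EuclideanSpace ℝ (Fin m) × EuclideanSpace ℝ (Fin m) =>
      (∫⁻ τ in Ioi (0 : ℝ), ∫⁻ s, (Iio (f z.1)).indicator (1 : ℝ → ℝ≥0∞) (τ + s) *
        (Ici (g z.2)).indicator 1 τ ∂ν) * radialKernel k (z.1 - z.2) := m1.mul (by fun_prop)
  have m2' : Measurable fun z : EuclideanSpace ℝ (Fin m) × EuclideanSpace ℝ (Fin m) =>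
      (∫⁻ τ in Ioi (0 : ℝ), ∫⁻ s, (Iio (g z.2)).indicator (1 : ℝ → ℝ≥0∞) (τ + s) *
        (Ici (f z.1)).indicator 1 τ ∂ν') * radialKernel k (z.1 - z.2) :=
    (m2.comp measurable_swap).mul (by fun_prop)
  have h1 : ∀ x, ∫⁻ y, ENNReal.ofReal (J (f x - g y) * k (x - y)) =
      (∫⁻ y, (∫⁻ τ in Ioi (0 : ℝ), ∫⁻ s, (Iio (f x)).indicator (1 : ℝ → ℝ≥0∞) (τ + s) *
        (Ici (g y)).indicator 1 τ ∂ν) * radialKernel k (x - y)) +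
      ∫⁻ y, (∫⁻ τ in Ioi (0 : ℝ), ∫⁻ s, (Iio (g y)).indicator (1 : ℝ → ℝ≥0∞) (τ + s) *
        (Ici (f x)).indicator 1 τ ∂ν') * radialKernel k (x - y) := by
    intro x
    have my : Measurable fun y => (∫⁻ τ in Ioi (0 : ℝ), ∫⁻ s,
        (Iio (f x)).indicator (1 : ℝ → ℝ≥0∞) (τ + s) * (Ici (g y)).indicator 1 τ ∂ν) *
          radialKernel k (x - y) := m1'.comp measurable_prodMk_left
    rw [← lintegral_add_left my]
    -- The value of the kernel at the origin enters only on the null set `y = x`.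
    have h0 : ∀ᵐ y : EuclideanSpace ℝ (Fin m), y ≠ x := by simp [ae_iff]
    refine lintegral_congr_ae (h0.mono fun y hy => ?_)
    dsimp only
    rw [← add_mul, ← ofReal_eq_layer_add_layer hJ_zero hν hν' (hf0 x) (hg0 y),
      radialKernel_of_ne_zero (sub_ne_zero.2 hy.symm), ENNReal.ofReal_mul (hJ_nonneg _)]
  unfold nonlocalEnergy
  simp_rw [h1]
  rw [lintegral_add_left (m1'.lintegral_prod_right' (ν := volume)),
    lintegral_layer_eq_layerEnergy mK hf hg, lintegral_lintegral_swap m2'.aemeasurable,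
    ← lintegral_layer_eq_layerEnergy mK hg hf]
  congr 1
  refine lintegral_congr fun y => lintegral_congr fun x => ?_
  rw [hK.congr_norm (norm_sub_rev x y)]

/-- The hypotheses under which rearrangements of superlevel sets are handled: a nonnegative
measurable function whose superlevel sets have finite measure. -/
structure IsRearrangeable (f : EuclideanSpace ℝ (Fin m) → ℝ) : Prop where
  measurable : Measurable f
  nonneg : ∀ x, 0 ≤ f x
  volume_lt_top : ∀ τ : ℝ, 0 < τ → volume {x | τ < f x} < ∞

theorem IsRearrangeable.volume_abs_lt_top (hf : IsRearrangeable f) (τ : ℝ) (hτ : 0 < τ) :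
    volume {x | τ < |f x|} < ∞ := by
  simp_rw [abs_of_nonneg (hf.nonneg _)]
  exact hf.volume_lt_top τ hτ

theorem IsRearrangeable.measurableSet_superlevel (hf : IsRearrangeable f) (τ : ℝ) :
    MeasurableSet {x | τ < f x} := measurableSet_lt measurable_const hf.measurable

theorem IsRearrangeable.exists_ball (hm : 1 ≤ m) (hf : IsRearrangeable f) {σ : ℝ} (hσ : 0 < σ) :
    ∃ r, volume {x | σ < f x} = volume (Metric.ball (0 : EuclideanSpace ℝ (Fin m)) r) ∧
      ({x | σ < symmDecrRearr f x} : Set (EuclideanSpace ℝ (Fin m))) =ᵐ[volume]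
        Metric.ball 0 r := by
  have h := superlevel_symmDecrRearr_ae_eq hm hf.measurable hf.volume_abs_lt_top hσ
  obtain ⟨r, -, hr, hv⟩ := exists_schwarzSymm_eq_ball hm (hf.volume_abs_lt_top σ hσ).ne
  rw [hr] at h
  simp_rw [abs_of_nonneg (hf.nonneg _)] at hv
  exact ⟨r, hv, h⟩

theorem exists_interaction_layer_rearr (hm : 1 ≤ m) (hf : IsRearrangeable f)
    (hg : IsRearrangeable g) (K : EuclideanSpace ℝ (Fin m) → ℝ≥0∞) {σ τ : ℝ} (hσ : 0 < σ)
    (hτ : 0 < τ) : ∃ r s : ℝ,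
      volume {x | σ < f x} = volume (Metric.ball (0 : EuclideanSpace ℝ (Fin m)) r) ∧
      volume {x | τ < g x} = volume (Metric.ball (0 : EuclideanSpace ℝ (Fin m)) s) ∧
      interaction K {x | σ < symmDecrRearr f x} {x | τ < symmDecrRearr g x}ᶜ =
        interaction K (Metric.ball 0 r) (Metric.ball 0 s)ᶜ := by
  obtain ⟨r, hr, hr'⟩ := hf.exists_ball hm hσ
  obtain ⟨s, hs, hs'⟩ := hg.exists_ball hm hτ
  exact ⟨r, s, hr, hs, interaction_congr hr' hs'.compl⟩

variable {K : EuclideanSpace ℝ (Fin m) → ℝ≥0∞}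

theorem IsLayerMeasure.ae_nonneg (hν : IsLayerMeasure J ν) : ∀ᵐ s ∂ν, 0 ≤ s := by
  rw [ae_iff]
  convert hν.measure_Iio_zero using 2
  ext s; simp

theorem interaction_layer_rearr_le (hm : 1 ≤ m) (hK : IsRadialKernel K) (hf : IsRearrangeable f)
    (hg : IsRearrangeable g) {σ τ : ℝ} (hσ : 0 < σ) (hτ : 0 < τ) :
    interaction K {x | σ < symmDecrRearr f x} {x | τ < symmDecrRearr g x}ᶜ ≤
      interaction K {x | σ < f x} {x | τ < g x}ᶜ := by
  have := nontrivial_euclideanSpace hm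
  obtain ⟨r, s, hr, hs, h⟩ := exists_interaction_layer_rearr hm hf hg K hσ hτ
  rw [h]
  exact interaction_compl_ball_le hK (hf.measurableSet_superlevel σ)
    (hg.measurableSet_superlevel τ) hr hs

theorem interaction_layer_rearr_eq_iff (hm : 1 ≤ m) (hK : IsRadialKernel K)
    (hKs : ∀ x y, ‖x‖ < ‖y‖ → K y < K x) (hf : IsRearrangeable f)
    (hg : IsRearrangeable g) {σ τ : ℝ} (hσ : 0 < σ) (hτ : 0 < τ) :
    interaction K {x | σ < symmDecrRearr f x} {x | τ < symmDecrRearr g x}ᶜ =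
      interaction K {x | σ < f x} {x | τ < g x}ᶜ ↔ Concentric {x | σ < f x} {x | τ < g x} := by
  have := nontrivial_euclideanSpace hm
  obtain ⟨r, s, hr, hs, h⟩ := exists_interaction_layer_rearr hm hf hg K hσ hτ
  rw [h]
  exact interaction_compl_eq_iff_concentric hK hKs (hf.measurableSet_superlevel σ)
    (hg.measurableSet_superlevel τ) hr hs

theorem ae_interaction_layer_rearr_le (hm : 1 ≤ m) (hK : IsRadialKernel K)
    (hν : IsLayerMeasure J ν) (hf : IsRearrangeable f) (hg : IsRearrangeable g) {τ : ℝ}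
    (hτ : 0 < τ) :
    ∀ᵐ s ∂ν, interaction K {x | τ + s < symmDecrRearr f x} {x | τ < symmDecrRearr g x}ᶜ ≤
      interaction K {x | τ + s < f x} {x | τ < g x}ᶜ :=
  hν.ae_nonneg.mono fun s hs => interaction_layer_rearr_le hm hK hf hg (by linarith) hτ

theorem layerEnergy_rearr_le (hm : 1 ≤ m) (hK : IsRadialKernel K) (hν : IsLayerMeasure J ν)
    (hf : IsRearrangeable f) (hg : IsRearrangeable g) :
    layerEnergy K ν (symmDecrRearr f) (symmDecrRearr g) ≤ layerEnergy K ν f g := by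
  refine lintegral_mono_ae ((ae_restrict_mem measurableSet_Ioi).mono fun τ hτ => ?_)
  exact lintegral_mono_ae (ae_interaction_layer_rearr_le hm hK hν hf hg hτ)

/-- The inequality holds at each pair of levels. By finiteness, equality of the integrals forces
equality for almost all `τ`, and then for almost all `s`. -/
theorem layerEnergy_rearr_eq_iff [SFinite ν] (hm : 1 ≤ m) (hK : IsRadialKernel K)
    (hKs : ∀ x y, ‖x‖ < ‖y‖ → K y < K x) (hν : IsLayerMeasure J ν) (hf : IsRearrangeable f)
    (hg : IsRearrangeable g) (hfin : layerEnergy K ν f g ≠ ∞) :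
    layerEnergy K ν (symmDecrRearr f) (symmDecrRearr g) = layerEnergy K ν f g ↔
      ∀ᵐ τ ∂(volume.restrict (Ioi (0 : ℝ))), ∀ᵐ s ∂ν,
        Concentric {x | τ + s < f x} {x | τ < g x} := by
  have mI := measurable_interaction_layer hK.measurable hf.measurable hg.measurable
  have mI' : Measurable fun τ : ℝ => ∫⁻ s, interaction K {x | τ + s < f x} {x | τ < g x}ᶜ ∂ν :=
    mI.lintegral_prod_right'
  constructor
  · intro h
    have hout := ae_eq_of_ae_le_of_lintegral_le
      ((ae_restrict_mem measurableSet_Ioi).mono fun τ hτ =>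
        lintegral_mono_ae (ae_interaction_layer_rearr_le hm hK hν hf hg hτ))
      (h.trans_ne hfin) mI'.aemeasurable h.ge
    filter_upwards [hout, ae_lt_top mI' hfin, ae_restrict_mem measurableSet_Ioi] with τ h1 h2 hτ
    have hin := ae_eq_of_ae_le_of_lintegral_le
      (ae_interaction_layer_rearr_le hm hK hν hf hg hτ) (h1.trans_ne h2.ne)
      (mI.comp measurable_prodMk_left).aemeasurable h1.ge
    filter_upwards [hin, hν.ae_nonneg] with s h3 hs
    have hτ' : 0 < τ := hτ
    exact (interaction_layer_rearr_eq_iff hm hK hKs hf hg (by linarith) hτ').1 h3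
  · intro h
    refine lintegral_congr_ae ?_
    filter_upwards [h, ae_restrict_mem measurableSet_Ioi] with τ h1 hτ
    refine lintegral_congr_ae ?_
    filter_upwards [h1, hν.ae_nonneg] with s h3 hs
    have hτ' : 0 < τ := hτ
    exact (interaction_layer_rearr_eq_iff hm hK hKs hf hg (by linarith) hτ').2 h3

theorem nonlocalEnergy_rearr_le_of_isLayerMeasure [SFinite ν] [SFinite ν'] (hm : 1 ≤ m)
    (hJ_nonneg : ∀ t, 0 ≤ J t) (hJ_zero : J 0 = 0) (hk_int : Integrable k volume)
    (hk : IsSymmDecr k) (hν : IsLayerMeasure J ν) (hν' : IsLayerMeasure (fun t => J (-t)) ν')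
    (hf : IsRearrangeable f) (hg : IsRearrangeable g) :
    nonlocalEnergy J k (symmDecrRearr f) (symmDecrRearr g) ≤ nonlocalEnergy J k f g := by
  have hK := isRadialKernel_radialKernel hm hk_int hk
  rw [nonlocalEnergy_eq_layerEnergy_add hm hJ_nonneg hJ_zero hk_int hk hν hν' hf.measurable
      hg.measurable hf.nonneg hg.nonneg,
    nonlocalEnergy_eq_layerEnergy_add hm hJ_nonneg hJ_zero hk_int hk hν hν'
      (measurable_symmDecrRearr hm hf.measurable hf.volume_abs_lt_top)
      (measurable_symmDecrRearr hm hg.measurable hg.volume_abs_lt_top)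
      (symmDecrRearr_nonneg f) (symmDecrRearr_nonneg g)]
  exact add_le_add (layerEnergy_rearr_le hm hK hν hf hg) (layerEnergy_rearr_le hm hK hν' hg hf)

/-- Both layer energies decrease under rearrangement and are finite, so equality of the sums is
equality of each. -/
theorem nonlocalEnergy_eq_iff_of_isLayerMeasure [SFinite ν] [SFinite ν'] (hm : 1 ≤ m)
    (hJ_nonneg : ∀ t, 0 ≤ J t) (hJ_zero : J 0 = 0) (hk_int : Integrable k volume)
    (hk : IsSymmDecr k) (hks : IsStrictSymmDecr k) (hν : IsLayerMeasure J ν)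
    (hν' : IsLayerMeasure (fun t => J (-t)) ν') (hf : IsRearrangeable f) (hg : IsRearrangeable g)
    (hfin : nonlocalEnergy J k f g < ∞) :
    nonlocalEnergy J k f g = nonlocalEnergy J k (symmDecrRearr f) (symmDecrRearr g) ↔
      (∀ᵐ τ ∂(volume.restrict (Ioi (0 : ℝ))), ∀ᵐ s ∂ν,
        Concentric {x | τ + s < f x} {x | τ < g x}) ∧
      ∀ᵐ τ ∂(volume.restrict (Ioi (0 : ℝ))), ∀ᵐ s ∂ν',
        Concentric {x | τ + s < g x} {x | τ < f x} := by
  have hK := isRadialKernel_radialKernel hm hk_int hk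
  have hKs := radialKernel_strict_anti hm hk_int hk hks
  have h1 := nonlocalEnergy_eq_layerEnergy_add hm hJ_nonneg hJ_zero hk_int hk hν hν' hf.measurable
      hg.measurable hf.nonneg hg.nonneg
  have h2 := nonlocalEnergy_eq_layerEnergy_add hm hJ_nonneg hJ_zero hk_int hk hν hν'
      (measurable_symmDecrRearr hm hf.measurable hf.volume_abs_lt_top)
      (measurable_symmDecrRearr hm hg.measurable hg.volume_abs_lt_top)
      (symmDecrRearr_nonneg f) (symmDecrRearr_nonneg g)
  rw [h1] at hfin
  obtain ⟨hfin1, hfin2⟩ := ENNReal.add_lt_top.1 hfin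
  rw [← layerEnergy_rearr_eq_iff hm hK hKs hν hf hg hfin1.ne,
    ← layerEnergy_rearr_eq_iff hm hK hKs hν' hg hf hfin2.ne, h1, h2]
  have hle1 := layerEnergy_rearr_le hm hK hν hf hg
  have hle2 := layerEnergy_rearr_le hm hK hν' hg hf
  constructor
  · intro h
    constructor
    · refine le_antisymm hle1 ?_
      refine (ENNReal.add_le_add_iff_right hfin2.ne).1 ?_
      rw [h]; gcongr
    · refine le_antisymm hle2 ?_
      refine (ENNReal.add_le_add_iff_left hfin1.ne).1 ?_
      rw [h]; gcongr
  · rintro ⟨h, h'⟩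
    rw [h, h']

end Energy

theorem exists_mem_of_ae {α : Type*} [MeasurableSpace α] {μ : Measure α} {S : Set α}
    {p : α → Prop} (hS : μ S ≠ 0) (h : ∀ᵐ x ∂μ, p x) : ∃ x ∈ S, p x := by
  by_contra! hn
  exact hS (measure_mono_null (fun x hx => hn x hx) (ae_iff.1 h))

/-- Finite measure bounds the radii, and a union of concentric open balls is the ball with their
supremum as radius. -/
theorem exists_iUnion_ae_eq_ball {E : Type*} [NormedAddCommGroup E] [InnerProductSpace ℝ E]
    [FiniteDimensional ℝ E] [MeasurableSpace E] [BorelSpace E] [Nontrivial E] {A : ℕ → Set E}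
    {c : E} (h : ∀ n, ∃ r, A n =ᵐ[volume] Metric.ball c r) (hfin : volume (⋃ n, A n) ≠ ∞) :
    ∃ r, (⋃ n, A n) =ᵐ[volume] Metric.ball c r := by
  choose r hr using h
  have hU : (⋃ n, A n) =ᵐ[volume] ⋃ n, Metric.ball c (r n) := Filter.EventuallyEq.countable_iUnion hr
  have hbdd : BddAbove (range r) := by
    by_contra hb
    rw [not_bddAbove_iff] at hb
    have huniv : ⋃ n, Metric.ball c (r n) = univ := by
      refine eq_univ_of_forall fun x => ?_
      obtain ⟨_, ⟨n, rfl⟩, hn⟩ := hb (dist x c)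
      exact mem_iUnion.2 ⟨n, hn⟩
    rw [measure_congr hU, huniv] at hfin
    exact hfin (measure_univ_of_isAddLeftInvariant volume)
  refine ⟨⨆ n, r n, ?_⟩
  have hb : ⋃ n, Metric.ball c (r n) = Metric.ball c (⨆ n, r n) := by
    ext x
    simp only [Metric.mem_ball, mem_iUnion]
    exact (lt_ciSup_iff hbdd).symm
  rwa [hb] at hU

/-! ### From concentric level sets to translates of the rearrangements -/

section Rigidity

variable {m : ℕ} {f g : EuclideanSpace ℝ (Fin m) → ℝ} {ν ν' : Measure ℝ}

theorem IsRearrangeable.ae_eq_zero_or (hf : IsRearrangeable f) :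
    f =ᵐ[volume] 0 ∨ ∃ τ > 0, volume {x | τ < f x} ≠ 0 := by
  by_contra! h
  refine h.1 ?_
  have h1 : ∀ᵐ x, ∀ n : ℕ, ¬ 1 / ((n : ℝ) + 1) < f x := ae_all_iff.2 fun n => by
    rw [ae_iff]
    simpa using h.2 (1 / ((n : ℝ) + 1)) (by positivity)
  filter_upwards [h1] with x hx
  refine le_antisymm ?_ (hf.nonneg x)
  by_contra! hpos
  obtain ⟨n, hn⟩ := exists_nat_one_div_lt hpos
  exact hx n hn

theorem volume_superlevel_ne_zero {σ τ : ℝ} (h : σ ≤ τ) (hτ : volume {x | τ < f x} ≠ 0) :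
    volume {x | σ < f x} ≠ 0 := fun h0 =>
  hτ (measure_mono_null (fun _ hx => h.trans_lt hx) h0)

/-- All superlevel sets of `f` are balls around the center of the ball `{τ < g}`, if they are
concentric with this ball for almost all levels above `τ`. -/
theorem exists_common_center_above (hm : 1 ≤ m) (hf : IsRearrangeable f) (hg : IsRearrangeable g)
    (hν : ∀ a b, 0 < a → a < b → ν (Ioo a b) ≠ 0) {τ τ₀ : ℝ} (hτ : 0 < τ) (hτ₀ : τ < τ₀)
    (hf0 : volume {x | τ₀ < f x} ≠ 0) (hg0 : volume {x | τ₀ < g x} ≠ 0)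
    (h : ∀ᵐ s ∂ν, Concentric {x | τ + s < f x} {x | τ < g x}) :
    ∃ c, (∃ r, {x | τ < g x} =ᵐ[volume] Metric.ball c r) ∧
      ∀ σ > τ, ∃ r, {x | σ < f x} =ᵐ[volume] Metric.ball c r := by
  have := nontrivial_euclideanSpace hm
  have hgτ := volume_superlevel_ne_zero hτ₀.le hg0
  -- With `τ + s₀ < τ₀` neither level set is null, so `{τ < g}` is a ball.
  obtain ⟨s₀, hs₀, h₀⟩ := exists_mem_of_ae
    (hν ((τ₀ - τ) / 2) (τ₀ - τ) (by linarith) (by linarith)) h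
  obtain h1 | h1 | ⟨c, r, r', hr, hr'⟩ := h₀
  · exact absurd h1 (volume_superlevel_ne_zero (by linarith [hs₀.2]) hf0)
  · exact absurd h1 hgτ
  refine ⟨c, ⟨r', hr'⟩, fun σ hσ => ?_⟩
  -- Good levels `τ + s n` converging to `σ` from above exhaust `{σ < f}`. They exist because `ν`
  -- charges every interval.
  have hs : ∀ n : ℕ, ∃ s ∈ Ioo (σ - τ) (σ - τ + 1 / ((n : ℝ) + 1)),
      Concentric {x | τ + s < f x} {x | τ < g x} := fun n =>
    exists_mem_of_ae (hν _ _ (by linarith) (by linarith [(by positivity : 0 < 1 / ((n : ℝ) + 1))])) h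
  choose s hs hsc using hs
  have hU : {x | σ < f x} = ⋃ n, {x | τ + s n < f x} := by
    ext x
    simp only [mem_iUnion, mem_ofPred_eq]
    constructor
    · intro hx
      obtain ⟨n, hn⟩ := exists_nat_one_div_lt (sub_pos.2 hx)
      exact ⟨n, by linarith [(hs n).2]⟩
    · rintro ⟨n, hn⟩
      linarith [(hs n).1]
  have hfin := (hf.volume_lt_top σ (hτ.trans hσ)).ne
  rw [hU] at hfin ⊢
  refine exists_iUnion_ae_eq_ball (fun n => ?_) hfin
  obtain h2 | h2 | ⟨c', t, t', ht, ht'⟩ := hsc n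
  · exact ⟨0, by rw [Metric.ball_zero]; exact ae_eq_empty.2 h2⟩
  · exact absurd h2 hgτ
  · have hcc := center_unique (hg.measurableSet_superlevel τ) (hg.volume_lt_top τ hτ).ne hgτ hr' ht'
    exact ⟨t, hcc ▸ ht⟩

/-- Good levels `τ` exist arbitrarily close to zero, and the centers they give agree because all are
centers of the non-null set `{τ₀ < f}`. One level set of `g` is recorded to identify this center
with that of `g` later. -/
theorem exists_common_center (hm : 1 ≤ m) (hf : IsRearrangeable f) (hg : IsRearrangeable g)
    (hν : ∀ a b, 0 < a → a < b → ν (Ioo a b) ≠ 0) {τ₀ : ℝ} (hτ₀ : 0 < τ₀)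
    (hf0 : volume {x | τ₀ < f x} ≠ 0) (hg0 : volume {x | τ₀ < g x} ≠ 0)
    (h : ∀ᵐ τ ∂(volume.restrict (Ioi (0 : ℝ))), ∀ᵐ s ∂ν,
      Concentric {x | τ + s < f x} {x | τ < g x}) :
    ∃ c, (∀ σ > 0, ∃ r, {x | σ < f x} =ᵐ[volume] Metric.ball c r) ∧
      ∃ τ > 0, volume {x | τ < g x} ≠ 0 ∧ ∃ r, {x | τ < g x} =ᵐ[volume] Metric.ball c r := by
  have key : ∀ σ, 0 < σ → ∃ τ ∈ Ioo 0 σ, ∀ᵐ s ∂ν, Concentric {x | τ + s < f x} {x | τ < g x} := by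
    intro σ hσ
    refine exists_mem_of_ae ?_ h
    rw [Measure.restrict_apply measurableSet_Ioo, inter_eq_left.2 fun x hx => hx.1]
    simp [hσ]
  obtain ⟨τ, hτ, hτc⟩ := key τ₀ hτ₀
  obtain ⟨c, hc, hcσ⟩ := exists_common_center_above hm hf hg hν hτ.1 hτ.2 hf0 hg0 hτc
  refine ⟨c, fun σ hσ => ?_, τ, hτ.1, volume_superlevel_ne_zero hτ.2.le hg0, hc⟩
  obtain ⟨τ', hτ', hτc'⟩ := key (min σ τ₀) (lt_min hσ hτ₀)
  have h1 := hτ'.2.trans_le (min_le_right _ _)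
  obtain ⟨c', -, hcσ'⟩ := exists_common_center_above hm hf hg hν hτ'.1 h1 hf0 hg0 hτc'
  obtain ⟨r, hr⟩ := hcσ τ₀ hτ.2
  obtain ⟨r', hr'⟩ := hcσ' τ₀ h1
  rw [center_unique (hf.measurableSet_superlevel τ₀) (hf.volume_lt_top τ₀ hτ₀).ne hf0 hr hr']
  exact hcσ' σ (hτ'.2.trans_le (min_le_left _ _))

theorem IsRearrangeable.exists_ball_translate (hm : 1 ≤ m) (hf : IsRearrangeable f)
    (c : EuclideanSpace ℝ (Fin m)) {σ : ℝ} (hσ : 0 < σ) :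
    ∃ r, volume {x | σ < f x} = volume (Metric.ball c r) ∧
      {x | σ < symmDecrRearr f (x - c)} =ᵐ[volume] Metric.ball c r := by
  obtain ⟨r, hr, hr'⟩ := hf.exists_ball hm hσ
  refine ⟨r, by rw [hr, Measure.addHaar_ball_center volume c], ?_⟩
  have h := (measurePreserving_sub_right volume c).quasiMeasurePreserving.preimage_ae_eq hr'
  have hb : (fun x => x - c) ⁻¹' Metric.ball 0 r = Metric.ball c r := by
    ext x; simp [dist_eq_norm]
  rwa [hb] at h

/-- Level sets of `f` and of the translated rearrangement have equal measure, so as balls around `c`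
they coincide up to null sets. Countably many rational levels determine a function. -/
theorem ae_eq_translate_iff (hm : 1 ≤ m) (hf : IsRearrangeable f)
    (c : EuclideanSpace ℝ (Fin m)) :
    (∀ᵐ x, f x = symmDecrRearr f (x - c)) ↔
      ∀ σ > 0, ∃ r, {x | σ < f x} =ᵐ[volume] Metric.ball c r := by
  constructor
  · intro h σ hσ
    obtain ⟨r, -, hr⟩ := hf.exists_ball_translate hm c hσ
    refine ⟨r, Filter.EventuallyEq.trans ?_ hr⟩
    exact Filter.eventuallyEq_set.2 (h.mono fun x hx => by simp only [mem_ofPred_eq, hx])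
  · intro h
    have h1 : ∀ᵐ x, ∀ q : ℚ, (0 : ℝ) < q → ((q : ℝ) < f x ↔ (q : ℝ) < symmDecrRearr f (x - c)) := by
      refine ae_all_iff.2 fun q => ?_
      by_cases hq : (0 : ℝ) < q
      · obtain ⟨r, hr⟩ := h q hq
        obtain ⟨r', hv, hr'⟩ := hf.exists_ball_translate hm c hq
        rw [measure_congr hr] at hv
        exact (hr.trans ((ball_ae_eq_ball hv).trans hr'.symm)).mem_iff.mono fun x hx _ => hx
      · exact .of_forall fun x hx => absurd hx hq
    filter_upwards [h1] with x hx
    rcases lt_trichotomy (f x) (symmDecrRearr f (x - c)) with hlt | heq | hlt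
    · obtain ⟨q, hq, hq'⟩ := exists_rat_btwn hlt
      exact absurd ((hx q ((hf.nonneg x).trans_lt hq)).2 hq') (not_lt.2 hq.le)
    · exact heq
    · obtain ⟨q, hq, hq'⟩ := exists_rat_btwn hlt
      exact absurd ((hx q ((symmDecrRearr_nonneg f _).trans_lt hq)).1 hq') (not_lt.2 hq.le)

theorem volume_superlevel_eq_zero (hf : f =ᵐ[volume] 0) {σ : ℝ} (hσ : 0 < σ) :
    volume {x | σ < f x} = 0 := by
  have h : ∀ᵐ x, ¬ σ < f x := hf.mono fun x hx => by simp [hx, hσ.le]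
  simpa [ae_iff] using h

theorem concentric_of_translate (hm : 1 ≤ m) (hν : ∀ᵐ s ∂ν, 0 ≤ s) (hf : IsRearrangeable f)
    (hg : IsRearrangeable g) (h : f =ᵐ[volume] 0 ∨ g =ᵐ[volume] 0 ∨
      ∃ c, ∀ᵐ x, f x = symmDecrRearr f (x - c) ∧ g x = symmDecrRearr g (x - c)) :
    ∀ᵐ τ ∂(volume.restrict (Ioi (0 : ℝ))), ∀ᵐ s ∂ν,
      Concentric {x | τ + s < f x} {x | τ < g x} := by
  filter_upwards [ae_restrict_mem measurableSet_Ioi] with τ hτ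
  filter_upwards [hν] with s hs
  have hτ' : 0 < τ := hτ
  obtain h | h | ⟨c, h⟩ := h
  · exact .inl (volume_superlevel_eq_zero h (by linarith))
  · exact .inr (.inl (volume_superlevel_eq_zero h hτ'))
  · rw [Filter.eventually_and] at h
    obtain ⟨r, hr⟩ := (ae_eq_translate_iff hm hf c).1 h.1 (τ + s) (by linarith)
    obtain ⟨r', hr'⟩ := (ae_eq_translate_iff hm hg c).1 h.2 τ hτ'
    exact .inr (.inr ⟨c, r, r', hr, hr'⟩)

/-- `ν` provides a center for `f` and `ν'` one for `g`. They agree since both are centers of one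
non-null level set of `g`. -/
theorem ae_concentric_iff_translate (hm : 1 ≤ m) (hf : IsRearrangeable f) (hg : IsRearrangeable g)
    (hν : ∀ a b, 0 < a → a < b → ν (Ioo a b) ≠ 0) (hν' : ∀ a b, 0 < a → a < b → ν' (Ioo a b) ≠ 0)
    (hν0 : ∀ᵐ s ∂ν, 0 ≤ s) (hν0' : ∀ᵐ s ∂ν', 0 ≤ s) :
    ((∀ᵐ τ ∂(volume.restrict (Ioi (0 : ℝ))), ∀ᵐ s ∂ν,
        Concentric {x | τ + s < f x} {x | τ < g x}) ∧
      ∀ᵐ τ ∂(volume.restrict (Ioi (0 : ℝ))), ∀ᵐ s ∂ν',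
        Concentric {x | τ + s < g x} {x | τ < f x}) ↔
      (f =ᵐ[volume] 0 ∨ g =ᵐ[volume] 0 ∨
        ∃ c, ∀ᵐ x, f x = symmDecrRearr f (x - c) ∧ g x = symmDecrRearr g (x - c)) := by
  constructor
  · rintro ⟨h, h'⟩
    obtain hf0 | ⟨τ₁, hτ₁, hf0⟩ := hf.ae_eq_zero_or
    · exact .inl hf0
    obtain hg0 | ⟨τ₂, hτ₂, hg0⟩ := hg.ae_eq_zero_or
    · exact .inr (.inl hg0)
    have hτ₀ : 0 < min τ₁ τ₂ := lt_min hτ₁ hτ₂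
    have hf1 := volume_superlevel_ne_zero (min_le_left τ₁ τ₂) hf0
    have hg1 := volume_superlevel_ne_zero (min_le_right τ₁ τ₂) hg0
    obtain ⟨c, hc, τ, hτ, hgτ, r, hr⟩ := exists_common_center hm hf hg hν hτ₀ hf1 hg1 h
    obtain ⟨c', hc', -⟩ := exists_common_center hm hg hf hν' hτ₀ hg1 hf1 h'
    obtain ⟨r', hr'⟩ := hc' τ hτ
    obtain rfl := center_unique (hg.measurableSet_superlevel τ) (hg.volume_lt_top τ hτ).ne hgτ hr hr'
    exact .inr (.inr ⟨c, Filter.eventually_and.2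
      ⟨(ae_eq_translate_iff hm hf c).2 hc, (ae_eq_translate_iff hm hg c).2 hc'⟩⟩)
  · intro h
    refine ⟨concentric_of_translate hm hν0 hf hg h, concentric_of_translate hm hν0' hg hf ?_⟩
    obtain h | h | ⟨c, h⟩ := h
    · exact .inr (.inl h)
    · exact .inl h
    · exact .inr (.inr ⟨c, h.mono fun x hx => hx.symm⟩)

theorem Concentric.symm {A B : Set (EuclideanSpace ℝ (Fin m))} (h : Concentric A B) :
    Concentric B A := by
  obtain h | h | ⟨c, r, s, hr, hs⟩ := h
  · exact .inr (.inl h)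
  · exact .inl h
  · exact .inr (.inr ⟨c, s, r, hs, hr⟩)

/-- The Dirac mass allows only `s = 0`: different levels are not coupled, and both conditions
coincide by symmetry. -/
theorem ae_concentric_dirac_iff :
    ((∀ᵐ τ ∂(volume.restrict (Ioi (0 : ℝ))), ∀ᵐ s ∂(Measure.dirac (0 : ℝ)),
        Concentric {x | τ + s < f x} {x | τ < g x}) ∧
      ∀ᵐ τ ∂(volume.restrict (Ioi (0 : ℝ))), ∀ᵐ s ∂(Measure.dirac (0 : ℝ)),
        Concentric {x | τ + s < g x} {x | τ < f x}) ↔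
      ∀ᵐ τ : ℝ, 0 < τ → Concentric {x | τ < f x} {x | τ < g x} := by
  simp only [ae_dirac_eq, Filter.eventually_pure, add_zero]
  simp only [ae_restrict_iff' (measurableSet_Ioi (a := (0 : ℝ))), mem_Ioi]
  exact ⟨fun h => h.1, fun h => ⟨h, h.mono fun τ hτ h0 => (hτ h0).symm⟩⟩

end Rigidity

/-! ### Reduction to Borel representatives, and the theorem -/

section Congr

variable {m : ℕ} {J : ℝ → ℝ} {k f f' g g' : EuclideanSpace ℝ (Fin m) → ℝ}

theorem symmDecrRearr_congr (h : f =ᵐ[volume] f') : symmDecrRearr f = symmDecrRearr f' := by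
  funext x
  unfold symmDecrRearr
  have hs : ∀ τ : ℝ, schwarzSymm {y | τ < |f y|} = schwarzSymm {y | τ < |f' y|} := fun τ =>
    schwarzSymm_congr (measure_congr (Filter.eventuallyEq_set.2 (h.mono fun y hy => by
      simp only [mem_ofPred_eq, hy])))
  simp_rw [hs]

theorem nonlocalEnergy_congr (hf : f =ᵐ[volume] f') (hg : g =ᵐ[volume] g') :
    nonlocalEnergy J k f g = nonlocalEnergy J k f' g' :=
  lintegral_congr_ae (hf.mono fun x hx => lintegral_congr_ae (hg.mono fun y hy => by
    simp only [hx, hy]))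

theorem superlevel_congr (h : f =ᵐ[volume] f') (τ : ℝ) :
    ({x | τ < f x} : Set (EuclideanSpace ℝ (Fin m))) =ᵐ[volume] {x | τ < f' x} :=
  Filter.eventuallyEq_set.2 (h.mono fun y hy => by simp only [mem_ofPred_eq, hy])

theorem Concentric.congr {A A' B B' : Set (EuclideanSpace ℝ (Fin m))} (hA : A =ᵐ[volume] A')
    (hB : B =ᵐ[volume] B') (h : Concentric A B) : Concentric A' B' := by
  obtain h | h | ⟨c, r, s, hr, hs⟩ := h
  · exact .inl (measure_congr hA ▸ h)
  · exact .inr (.inl (measure_congr hB ▸ h))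
  · exact .inr (.inr ⟨c, r, s, hA.symm.trans hr, hB.symm.trans hs⟩)

/-- Taking the positive part of a measurable representative restores nonnegativity at every point.
-/
theorem exists_isRearrangeable_ae_eq (hf : AEMeasurable f volume) (hf0 : ∀ x, 0 ≤ f x)
    (hfin : ∀ τ : ℝ, 0 < τ → volume {x | τ < f x} < ⊤) :
    ∃ f', IsRearrangeable f' ∧ f =ᵐ[volume] f' := by
  have h : f =ᵐ[volume] fun x => max (hf.mk f x) 0 := hf.ae_eq_mk.mono fun x hx => by
    dsimp only
    rw [← hx, max_eq_left (hf0 x)]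
  refine ⟨_, ⟨hf.measurable_mk.max measurable_const, fun x => le_max_right _ _, fun τ hτ => ?_⟩, h⟩
  rw [← measure_congr (superlevel_congr h τ)]
  exact hfin τ hτ

end Congr

theorem ConvexOn.comp_neg_univ {J : ℝ → ℝ} (h : ConvexOn ℝ univ J) :
    ConvexOn ℝ univ fun t => J (-t) :=
  ⟨convex_univ, fun x _ y _ a b ha hb hab => by
    have := h.2 (mem_univ (-x)) (mem_univ (-y)) ha hb hab
    simpa [neg_add_rev, add_comm] using this⟩

theorem StrictConvexOn.comp_neg_univ {J : ℝ → ℝ} (h : StrictConvexOn ℝ univ J) :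
    StrictConvexOn ℝ univ fun t => J (-t) :=
  ⟨convex_univ, fun x _ y _ hxy a b ha hb hab => by
    have := h.2 (mem_univ (-x)) (mem_univ (-y)) (neg_injective.ne hxy) ha hb hab
    simpa [neg_add_rev, add_comm] using this⟩

theorem mainTheorem5 {m : ℕ} (hm : 1 ≤ m)
    (J : ℝ → ℝ) (hJ_nonneg : ∀ t, 0 ≤ J t) (hJ_convex : ConvexOn ℝ univ J) (hJ_zero : J 0 = 0)
    (k : EuclideanSpace ℝ (Fin m) → ℝ) (hk_int : Integrable k volume) (hk : IsSymmDecr k)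
    (f g : EuclideanSpace ℝ (Fin m) → ℝ)
    (hf_meas : AEMeasurable f volume) (hg_meas : AEMeasurable g volume)
    (hf_nonneg : ∀ x, 0 ≤ f x) (hg_nonneg : ∀ x, 0 ≤ g x)
    (hf_fin : ∀ τ : ℝ, 0 < τ → volume {x | τ < f x} < ⊤)
    (hg_fin : ∀ τ : ℝ, 0 < τ → volume {x | τ < g x} < ⊤) :
    nonlocalEnergy J k (symmDecrRearr f) (symmDecrRearr g) ≤ nonlocalEnergy J k f g ∧
    (nonlocalEnergy J k f g < ⊤ → IsStrictSymmDecr k →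
      (StrictConvexOn ℝ univ J →
        (nonlocalEnergy J k f g = nonlocalEnergy J k (symmDecrRearr f) (symmDecrRearr g) ↔
          (f =ᵐ[volume] 0 ∨ g =ᵐ[volume] 0 ∨
            ∃ c : EuclideanSpace ℝ (Fin m), ∀ᵐ x ∂volume,
              f x = symmDecrRearr f (x - c) ∧ g x = symmDecrRearr g (x - c)))) ∧
      ((∀ t, J t = |t|) →
        (nonlocalEnergy J k f g = nonlocalEnergy J k (symmDecrRearr f) (symmDecrRearr g) ↔
          ∀ᵐ τ : ℝ ∂volume, 0 < τ →
            (volume {x | τ < f x} = 0 ∨ volume {x | τ < g x} = 0 ∨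
              ∃ (c : EuclideanSpace ℝ (Fin m)) (r s : ℝ),
                {x | τ < f x} =ᵐ[volume] Metric.ball c r ∧
                {x | τ < g x} =ᵐ[volume] Metric.ball c s)))) := by

  obtain ⟨f', hf', hff⟩ := exists_isRearrangeable_ae_eq hf_meas hf_nonneg hf_fin
  obtain ⟨g', hg', hgg⟩ := exists_isRearrangeable_ae_eq hg_meas hg_nonneg hg_fin
  rw [symmDecrRearr_congr hff, symmDecrRearr_congr hgg, nonlocalEnergy_congr hff hgg]
  obtain ⟨ν, hνs, hν, hνp⟩ := exists_isLayerMeasure hJ_nonneg hJ_convex hJ_zero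
  obtain ⟨ν', hνs', hν', hνp'⟩ := exists_isLayerMeasure (J := fun t => J (-t))
    (fun t => hJ_nonneg _) hJ_convex.comp_neg_univ (by simpa using hJ_zero)
  refine ⟨nonlocalEnergy_rearr_le_of_isLayerMeasure hm hJ_nonneg hJ_zero hk_int hk hν hν' hf' hg',
    fun hfin hks => ⟨fun hJs => ?_, fun hJ => ?_⟩⟩
  · rw [nonlocalEnergy_eq_iff_of_isLayerMeasure hm hJ_nonneg hJ_zero hk_int hk hks hν hν' hf' hg'
      hfin, ae_concentric_iff_translate hm hf' hg' (hνp hJs) (hνp' hJs.comp_neg_univ)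
      hν.ae_nonneg hν'.ae_nonneg]
    refine or_congr (Filter.EventuallyEq.congr_left hff).symm (or_congr
      (Filter.EventuallyEq.congr_left hgg).symm (exists_congr fun c => ?_))
    refine Filter.eventually_congr ?_
    filter_upwards [hff, hgg] with x hx hy
    rw [hx, hy]
  -- Here the explicit Dirac mass is used for both `J` and its reflection, in place of the measures
  -- obtained from convexity.
  · rw [nonlocalEnergy_eq_iff_of_isLayerMeasure hm hJ_nonneg hJ_zero hk_int hk hks
      (isLayerMeasure_abs hJ) (isLayerMeasure_abs fun t => by rw [hJ, abs_neg]) hf' hg' hfin,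
      ae_concentric_dirac_iff]
    refine Filter.eventually_congr (.of_forall fun τ => imp_congr_right fun _ => ?_)
    have h1 := superlevel_congr hff τ
    have h2 := superlevel_congr hgg τ
    exact ⟨Concentric.congr h1.symm h2.symm, Concentric.congr h1 h2⟩
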